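/- Theorem. Let $R$ be a commutative ring, $\mathcal V_R$ the category of finitely generated projective $R$-modules and $\mathcal F_R$ the category of all functors $\mathcal V_R\to R\text{-Mod}$. Let $\mathcal A$ be a full subcategory of $\mathcal F_R$ which is an abelian category with enough projectives and enough injectives, and which is stable under the operations $F\mapsto F(M\otimes_R-)$ and $F\mapsto F(\operatorname{Hom}_R(M,-))$ for all $M\in\mathcal V_R$. A functor $F\in\mathcal F_R$ has degree $-\infty$ if it is zero; if nonzero, it has degree $0$ if its first cross effect $\mathrm{Cr}_1F$ vanishes, and degree $d>0$ if $\mathrm{Cr}_{d+1}F=0$ and $\mathrm{Cr}_dF\neq 0$. Here $\mathrm{Cr}_1F(X)=\ker(F(X)\to F(0))$, and $\mathrm{Cr}_{d}F(X_1,\dots,X_d)$ is the complement of $\mathrm{Cr}_{d-1}F(X_1,X_3,\dots,X_d)\oplus \mathrm{Cr}_{d-1}F(X_2,X_3,\dots,X_d)$ in $\mathrm{Cr}_{d-1}F(X_1\oplus X_2,X_3,\dots,X_d)$, i.e. the common kernel of the maps induced by the two projections of $X_1\oplus X_2$. $F$ is polynomial if it has a degree, denoted $\deg F$. For $s\ge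 0$ let $\Gamma^s\mathcal V_R$ be the $R$-linear category with the objects of $\mathcal V_R$ and with the $\mathfrak S_s$-equivariant $R$-linear maps $M^{\otimes s}\to N^{\otimes s}$ as morphisms $M\to N$, and let $\mathcal P_{s,R}$ be the category of $R$-linear functors $\Gamma^s\mathcal V_R\to R\text{-Mod}$. An object of $\mathcal P_{s,R}$ has an underlying functor in $\mathcal F_R$, obtained by precomposition with $\mathcal V_R\to\Gamma^s\mathcal V_R$, $f\mapsto f^{\otimes s}$. For a prime $p$ let $\mathrm{DIG}_p(s)$ be the sum of the digits of $s$ in base $p$, and $\mathrm{INT}(p,s)=\{n\in\mathbb N : n\equiv s \bmod (p-1),\ \mathrm{DIG}_p(s)\le n\le s\}$. Let $s\ge 1$, let $F\in\mathcal A$ be a polynomial functor with $\deg F<s$, and let $G\in\mathcal P_{s,R}$ have its underlying functor in $\mathcal A$. Then for all $i\ge 0$: (i) $\operatorname{Ext}^i_{\mathcal A}(F,G)$ is a torsion abelian group. (ii) For every prime $p$, the $p$-primary part of $\operatorname{Ext}^i_{\mathcal A}(F,G)$ is annihilated by $p^{\max(r,0)}$, where $r=\left\lceil\frac{\deg F+1-\mathrm{DIG}_p(s)}{p-1}\right\rceil$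 (in particular it is zero if $\deg F<\mathrm{DIG}_p(s)$; for $F=0$ read $\max(r,0)=0$). (iii) If moreover $F$ is isomorphic to the underlying functor of an object of $\mathcal P_{t,R}$ for some $t\ge 0$, then for every prime $p$ with $\mathrm{INT}(p,t)\cap\mathrm{INT}(p,s)=\emptyset$, the $p$-primary part of $\operatorname{Ext}^i_{\mathcal A}(F,G)$ is zero. -/

import Mathlib

open CategoryTheory TensorProduct

universe u v w

namespace PolyFun

noncomputable section

/-! ## Finitely generated projective modules -/

/-- The property of being a finitely generated projective `R`-module. -/
def fgProj (R : Type u) [CommRing R] : ObjectProperty (ModuleCat.{u} R) :=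
  fun M => Module.Finite R M ∧ Module.Projective R M

/-- The category `V_R` of finitely generated projective `R`-modules and `R`-linear maps. -/
abbrev VR (R : Type u) [CommRing R] := (fgProj R).FullSubcategory

variable {R : Type u} [CommRing R]

instance (M : VR R) : Module.Finite R M.obj := M.property.1

instance (M : VR R) : Module.Projective R M.obj := M.property.2

/-- A finitely generated projective module, as an object of `V_R`. -/
def VR.of (R : Type u) [CommRing R] (M : Type u) [AddCommGroup M] [Module R M]
    [Module.Finite R M] [Module.Projective R M] : VR R :=
  ⟨ModuleCat.of R M, ⟨inferInstanceAs (Module.Finite R M),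
    inferInstanceAs (Module.Projective R M)⟩⟩

/-- A linear map, as a morphism of `V_R`. -/
def VR.ofHom {M N : VR R} (f : M.obj →ₗ[R] N.obj) : M ⟶ N := ⟨ModuleCat.ofHom f⟩

/-- The linear map underlying a morphism of `V_R`. -/
def VR.lin {M N : VR R} (f : M ⟶ N) : M.obj →ₗ[R] N.obj := f.hom.hom

/-- The zero module. -/
def VR.zero (R : Type u) [CommRing R] : VR R := VR.of R PUnit.{u + 1}

/-- The direct sum of two finitely generated projective modules. -/
def VR.sum (X Y : VR R) : VR R := VR.of R (X.obj × Y.obj)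

/-- The first projection `X ⊕ Y ⟶ X`. -/
def VR.fst (X Y : VR R) : X.sum Y ⟶ X := VR.ofHom (LinearMap.fst R X.obj Y.obj)

/-- The second projection `X ⊕ Y ⟶ Y`. -/
def VR.snd (X Y : VR R) : X.sum Y ⟶ Y := VR.ofHom (LinearMap.snd R X.obj Y.obj)

/-- The morphism `f ⊕ id : X ⊕ Y ⟶ X' ⊕ Y`. -/
def VR.sumMap {X X' : VR R} (f : X ⟶ X') (Y : VR R) : X.sum Y ⟶ X'.sum Y :=
  VR.ofHom (M := X.sum Y) (N := X'.sum Y) ((VR.lin f).prodMap LinearMap.id)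

/-- The functor `X ↦ X ⊕ Y`. -/
def VR.addRight (Y : VR R) : VR R ⥤ VR R where
  obj X := X.sum Y
  map f := VR.sumMap f Y

/-- The functor `N ↦ M ⊗ N`. -/
def VR.tensor (M : VR R) : VR R ⥤ VR R where
  obj N := VR.of R (M.obj ⊗[R] N.obj)
  map {N N'} f := VR.ofHom (M := VR.of R (M.obj ⊗[R] N.obj)) (N := VR.of R (M.obj ⊗[R] N'.obj))
    ((VR.lin f).lTensor M.obj)
  map_id N := by
    apply ObjectProperty.hom_ext; apply ModuleCat.hom_ext
    exact LinearMap.lTensor_id _ _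
  map_comp f g := by
    apply ObjectProperty.hom_ext; apply ModuleCat.hom_ext
    exact LinearMap.lTensor_comp _ _ _

theorem finite_projective_hom (M N : VR R) :
    Module.Finite R (M.obj →ₗ[R] N.obj) ∧ Module.Projective R (M.obj →ₗ[R] N.obj) := by
  obtain ⟨n, f, g, -, -, h⟩ := Module.Finite.exists_comp_eq_id_of_projective R M.obj
  let E : (Fin n → N.obj) ≃ₗ[R] ((Fin n → R) →ₗ[R] N.obj) := (Pi.basisFun R (Fin n)).constr R
  have h1 : Module.Finite R ((Fin n → R) →ₗ[R] N.obj) := Module.Finite.equiv E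
  have h0 : Module.Projective R (Fin n → N.obj) :=
    Module.Projective.of_equiv (DFinsupp.linearEquivFunOnFintype (R := R) (M := fun _ => N.obj))
  have h2 : Module.Projective R ((Fin n → R) →ₗ[R] N.obj) := Module.Projective.of_equiv E
  -- the maps induced by `g` and `f` exhibit `Hom(M, N)` as a retract of `Hom(R^n, N)`
  have hgf : (LinearMap.lcomp R N.obj g) ∘ₗ (LinearMap.lcomp R N.obj f) = LinearMap.id := by
    ext φ x
    have hx : f (g x) = x := LinearMap.congr_fun h x
    simp [hx]
  refine ⟨Module.Finite.of_surjective (LinearMap.lcomp R N.obj g) fun φ =>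
    ⟨LinearMap.lcomp R N.obj f φ, LinearMap.congr_fun hgf φ⟩, ?_⟩
  exact Module.Projective.of_split _ _ hgf

instance (M N : VR R) : Module.Finite R (M.obj →ₗ[R] N.obj) := (finite_projective_hom M N).1

instance (M N : VR R) : Module.Projective R (M.obj →ₗ[R] N.obj) := (finite_projective_hom M N).2

/-- The functor `N ↦ Hom_R(M, N)`. -/
def VR.homFrom (M : VR R) : VR R ⥤ VR R where
  obj N := VR.of R (M.obj →ₗ[R] N.obj)
  map {N N'} f := VR.ofHom (M := VR.of R (M.obj →ₗ[R] N.obj)) (N := VR.of R (M.obj →ₗ[R] N'.obj))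
    (LinearMap.llcomp R M.obj N.obj N'.obj (VR.lin f))

/-! ## Cross effects and degree

The functors are allowed to take values in modules of any universe level. -/

/-- The subfunctor of `K` given by a family of submodules that is stable under all `K(f)`. -/
def subfunctor (K : VR R ⥤ ModuleCat.{v} R) (S : ∀ X, Submodule R (K.obj X))
    (hS : ∀ {X Y : VR R} (f : X ⟶ Y), ∀ x ∈ S X, (K.map f).hom x ∈ S Y) :
    VR R ⥤ ModuleCat.{v} R where
  obj X := ModuleCat.of R (S X)
  map f := ModuleCat.ofHom ((K.map f).hom.restrict (hS f))
  map_id X := by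
    apply ModuleCat.hom_ext; ext x
    simp
  map_comp f g := by
    apply ModuleCat.hom_ext; ext x
    simp

/-- The reduced part `Cr₁ F(X)` of `F(X)`: the kernel of `F(X) → F(0)`. -/
def reducedPart (F : VR R ⥤ ModuleCat.{v} R) : VR R ⥤ ModuleCat.{v} R :=
  subfunctor F (fun X => LinearMap.ker (F.map (0 : X ⟶ VR.zero R)).hom) (by
    intro X Y f x hx
    have h : f ≫ (0 : Y ⟶ VR.zero R) = 0 := Limits.comp_zero
    rw [LinearMap.mem_ker] at hx ⊢
    rw [← ModuleCat.comp_apply, ← F.map_comp, h]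
    exact hx)

/-- The non-additivity of `H` with respect to its variable: the part of `H(X ⊕ Y)` complementary
to `H(X)` and `H(Y)` for a reduced `H`, that is, the intersection of the kernels of
`H(X ⊕ Y) → H(X)` and `H(X ⊕ Y) → H(Y)`, as a functor of `X`. -/
def deviation (H : VR R ⥤ ModuleCat.{v} R) (Y : VR R) : VR R ⥤ ModuleCat.{v} R :=
  subfunctor (VR.addRight Y ⋙ H)
    (fun X => LinearMap.ker (H.map (VR.fst X Y)).hom ⊓ LinearMap.ker (H.map (VR.snd X Y)).hom) (by
    intro X X' f x hx
    obtain ⟨h1, h2⟩ := hx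
    have e1 : VR.sumMap f Y ≫ VR.fst X' Y = VR.fst X Y ≫ f := rfl
    have e2 : VR.sumMap f Y ≫ VR.snd X' Y = VR.snd X Y := rfl
    have k1 : (H.map (VR.fst X' Y)).hom ((H.map (VR.sumMap f Y)).hom x) =
        (H.map f).hom ((H.map (VR.fst X Y)).hom x) :=
      LinearMap.congr_fun (congrArg ModuleCat.Hom.hom
        ((H.map_comp _ _).symm.trans ((congrArg H.map e1).trans (H.map_comp _ _)))) x
    have k2 : (H.map (VR.snd X' Y)).hom ((H.map (VR.sumMap f Y)).hom x) =
        (H.map (VR.snd X Y)).hom x :=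
      LinearMap.congr_fun (congrArg ModuleCat.Hom.hom
        ((H.map_comp _ _).symm.trans (congrArg H.map e2))) x
    refine ⟨?_, k2.trans h2⟩
    exact k1.trans ((congrArg (H.map f).hom h1).trans (map_zero _)))

/-- The cross effect `Cr_d F (X, X₂, …, X_d)` with `d = L.length + 1` and `L = [X₂, …, X_d]`,
as a functor of its first variable `X`. It measures the non-additivity of
`Cr_{d-1} F (X, X₃, …, X_d)` with respect to its first variable:
`Cr_{d-1} F (X ⊕ X₂, X₃, …)` is the direct sum of `Cr_d F (X, X₂, X₃, …)`,
`Cr_{d-1} F (X, X₃, …)` and `Cr_{d-1} F (X₂, X₃, …)`. -/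
def crossEffect (F : VR R ⥤ ModuleCat.{v} R) : List (VR R) → (VR R ⥤ ModuleCat.{v} R)
  | [] => reducedPart F
  | Y :: L => deviation (crossEffect F L) Y

/-- `F` is polynomial of degree at most `d`: its cross effect `Cr_{d+1} F` is zero. -/
def DegreeLE (F : VR R ⥤ ModuleCat.{v} R) (d : ℕ) : Prop :=
  ∀ L : List (VR R), L.length = d → ∀ X : VR R, Subsingleton ((crossEffect F L).obj X)

/-- `F` is polynomial of degree `d`. The zero functor is the one of degree `-∞`, a nonzero
functor has degree `0` if `Cr₁ F = 0`, and it has degree `d > 0` if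
`Cr_{d+1} F = 0` and `Cr_d F ≠ 0`. -/
def HasDegree (F : VR R ⥤ ModuleCat.{v} R) : WithBot ℕ → Prop
  | none => ∀ X, Subsingleton (F.obj X)
  | some 0 => DegreeLE F 0 ∧ ∃ X, Nontrivial (F.obj X)
  | some (d + 1) => DegreeLE F (d + 1) ∧ ¬ DegreeLE F d

/-! ## Strict polynomial functors -/

/-- The `R`-module of `S_s`-equivariant linear maps `M^{⊗s} → N^{⊗s}`, where the symmetric group
permutes the tensor factors. -/
def equivariantMaps (s : ℕ) (M N : VR R) :
    Submodule R ((⨂[R] _ : Fin s, M.obj) →ₗ[R] (⨂[R] _ : Fin s, N.obj)) where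
  carrier := {f | ∀ (σ : Equiv.Perm (Fin s)) (x : ⨂[R] _ : Fin s, M.obj),
    f (PiTensorProduct.reindex R (fun _ : Fin s => (M.obj : Type u)) σ x) =
      PiTensorProduct.reindex R (fun _ : Fin s => (N.obj : Type u)) σ (f x)}
  add_mem' := by
    intro f g hf hg σ x
    simp only [LinearMap.add_apply, hf σ x, hg σ x, map_add]
  zero_mem' := by
    intro σ x
    simp only [LinearMap.zero_apply, map_zero]
  smul_mem' := by
    intro c f hf σ x
    simp only [LinearMap.smul_apply, hf σ x, map_smul]

/-- The objects of the Schur category `Γ^s V_R`: the same as those of `V_R`. -/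
structure SchurCat (R : Type u) [CommRing R] (s : ℕ) where
  /-- the underlying finitely generated projective module -/
  toVR : VR R

instance (s : ℕ) : Category.{u} (SchurCat R s) where
  Hom M N := equivariantMaps s M.toVR N.toVR
  id M := ⟨LinearMap.id, fun _ _ => rfl⟩
  comp f g := ⟨g.1 ∘ₗ f.1, fun σ x => by
    simp only [LinearMap.comp_apply, f.2 σ x, g.2 σ (f.1 x)]⟩

instance (s : ℕ) : Preadditive (SchurCat R s) where
  homGroup M N := inferInstanceAs (AddCommGroup (equivariantMaps s M.toVR N.toVR))
  add_comp _ _ _ _ _ _ := Subtype.ext (LinearMap.comp_add _ _ _)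
  comp_add _ _ _ _ _ _ := Subtype.ext (LinearMap.add_comp _ _ _)

instance (s : ℕ) : Linear R (SchurCat R s) where
  homModule M N := inferInstanceAs (Module R (equivariantMaps s M.toVR N.toVR))
  smul_comp _ _ _ _ _ _ := Subtype.ext (LinearMap.comp_smul _ _ _)
  comp_smul _ _ _ _ _ _ := Subtype.ext (LinearMap.smul_comp _ _ _)

theorem map_mem_equivariantMaps (s : ℕ) {M N : VR R} (f : M ⟶ N) :
    PiTensorProduct.map (fun _ : Fin s => VR.lin f) ∈ equivariantMaps s M N := by
  intro σ x
  induction x using PiTensorProduct.induction_on with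
  | smul_tprod r m => simp
  | add x y hx hy => simp only [map_add, hx, hy]

/-- The functor `γ_s : V_R ⥤ Γ^s V_R`, the identity on objects and `f ↦ f^{⊗s}` on morphisms. -/
def gammaFunctor (R : Type u) [CommRing R] (s : ℕ) : VR R ⥤ SchurCat R s where
  obj M := ⟨M⟩
  map f := ⟨PiTensorProduct.map (fun _ : Fin s => VR.lin f), map_mem_equivariantMaps s f⟩
  map_id _ := Subtype.ext PiTensorProduct.map_id
  map_comp _ _ := Subtype.ext (PiTensorProduct.map_comp _ _)

/-- An object of `P_{s,R}`: a homogeneous strict polynomial functor of weight `s`, that is, an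
`R`-linear functor from the Schur category `Γ^s V_R` to `R`-modules. -/
structure StrictPoly (R : Type u) [CommRing R] (s : ℕ) where
  /-- the functor on the Schur category -/
  toFunctor : SchurCat R s ⥤ ModuleCat.{v} R
  /-- it is additive -/
  additive : toFunctor.Additive
  /-- it is `R`-linear -/
  linear : toFunctor.Linear R

/-- The underlying ordinary functor of a strict polynomial functor. -/
def StrictPoly.underlying {s : ℕ} (F : StrictPoly.{u, v} R s) : VR R ⥤ ModuleCat.{v} R :=
  gammaFunctor R s ⋙ F.toFunctor

/-! ## The numerical invariants -/

/-- The sum of the digits of the expansion of `s` in base `p`. -/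
def digitSum (p s : ℕ) : ℕ := (Nat.digits p s).sum

/-- The set of the integers `n` with `n ≡ s` modulo `p - 1` and `digitSum p s ≤ n ≤ s`. -/
def interval (p s : ℕ) : Set ℕ := {n | n ≡ s [MOD p - 1] ∧ digitSum p s ≤ n ∧ n ≤ s}

/-- The exponent `⌈(d + 1 - digitSum p s) / (p - 1)⌉`, to be read as `0` if it is negative
(in particular for `d = -∞`). -/
def torsionExponent (p s : ℕ) : WithBot ℕ → ℕ
  | none => 0
  | some d => (⌈((d : ℚ) + 1 - (digitSum p s : ℚ)) / ((p : ℚ) - 1)⌉ : ℤ).toNat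

end

end PolyFun

/-!
The functor `H ↦ H(R^n ⊗ -)` on the subcategory is exact, because `R^n` is its own dual, so that
the functor is adjoint to itself on both sides (`precompFreeAdjunction`). The maps `x ↦ e_i ⊗ x`
give a transformation `δ : H ⟶ H(R^n ⊗ -)`, the alternating sum over `S ⊆ {1, …, n}` of the maps
`H(∑_{i ∈ S} e_i ⊗ -)` (`precompFreeUnit`).

* If `F` is polynomial of degree less than `n`, then `δ` vanishes on `F`
  (`DegreeLE.vanishingAltSums`). Naturality of `Ext` with respect to transformations of exact
  functors (`mapExactFunctor_naturality`) then shows that composing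
  any class in `Ext(F, G)` with `δ` on `G` gives zero.
* If `G` has weight `s`, then expanding `(∑_{i ∈ S} e_i)^{⊗ s}` shows that `δ` on `G` is, up to
  sign, the sum over the compositions `ν` of `s` into `n` positive parts of the components of
  multidegree `ν`. Composing it with the dual component back to `G` gives multiplication by the
  multinomial coefficient of `ν` (`StrictPoly.exists_altUnit_comp`).

Hence these multinomial coefficients kill `Ext(F, G)` (`card_nsmul_ext_eq_zero_of_left`). When the
parts of `ν` are powers of `p`, Legendre's formula gives the `p`-adic valuation
`(n - digitSum p s) / (p - 1)`, and `n` can be any number congruent to `s` modulo `p - 1` between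
`digitSum p s` and `s` (`exists_padicValNat_card_mapsWithFibers`). The least such `n` larger than
`deg F` gives torsion and the bound on the exponent.

If `F` has a weight `t` too, let `x ∈ Ext(F, G)` be nonzero with `p x = 0`. An integer `c` acts on
`x` by `c ^ s` through `G` and by `c ^ t` through `F`, so `s ≡ t` modulo `p - 1`. As `F` has degree
at most `t`, the first part gives `digitSum p s ≤ t`; the dual argument, with the coordinate
projections `R^n ⊗ X ⟶ X` and the weight of `F`, gives `digitSum p t ≤ s`. These three facts put
`min s t` into both intervals.
-/

namespace PolyFun

/-! ### Multinomial coefficients and sums of powers of a prime -/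

/-- The maps `f : Fin s → Fin n` whose fibre over `i` has `ν i` elements. -/
def mapsWithFibers (s : ℕ) {n : ℕ} (ν : Fin n → ℕ) : Finset (Fin s → Fin n) :=
  Finset.univ.filter fun f => ∀ i, Fintype.card {j // f j = i} = ν i

theorem mem_mapsWithFibers {s n : ℕ} {ν : Fin n → ℕ} {f : Fin s → Fin n} :
    f ∈ mapsWithFibers s ν ↔ ∀ i, Fintype.card {j // f j = i} = ν i := by
  simp [mapsWithFibers]

theorem comp_perm_mem_mapsWithFibers {s n : ℕ} {ν : Fin n → ℕ} {f : Fin s → Fin n}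
    (σ : Equiv.Perm (Fin s)) (hf : f ∈ mapsWithFibers s ν) : f ∘ σ ∈ mapsWithFibers s ν := by
  rw [mem_mapsWithFibers] at hf ⊢
  intro i
  rw [← hf i]
  exact Fintype.card_congr (σ.subtypeEquiv fun _ => Iff.rfl)

theorem surjective_of_mem_mapsWithFibers {s n : ℕ} {ν : Fin n → ℕ} (hν : ∀ i, 0 < ν i)
    {f : Fin s → Fin n} (hf : f ∈ mapsWithFibers s ν) : Function.Surjective f := by
  intro i
  have h := hν i
  rw [← mem_mapsWithFibers.1 hf i, Fintype.card_pos_iff] at h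
  obtain ⟨j, hj⟩ := h
  exact ⟨j, hj⟩

theorem mapsWithFibers_nonempty {s n : ℕ} {ν : Fin n → ℕ} (hν : ∑ i, ν i = s) :
    (mapsWithFibers s ν).Nonempty := by
  have e : Fin s ≃ Σ i, Fin (ν i) := Fintype.equivOfCardEq (by simp [hν])
  refine ⟨fun j => (e j).1, mem_mapsWithFibers.2 fun i => ?_⟩
  rw [← Fintype.card_fin (ν i)]
  exact Fintype.card_congr
    ((e.subtypeEquiv fun _ => Iff.rfl).trans (Equiv.sigmaSubtype i))

/-- The number of maps with fibres of prescribed cardinalities is a multinomial coefficient: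
`Perm (Fin s)` acts transitively on them, with stabilizers of order `∏ i, (ν i)!`. -/
theorem card_mapsWithFibers_mul {s n : ℕ} {ν : Fin n → ℕ} (hν : ∑ i, ν i = s) :
    (mapsWithFibers s ν).card * ∏ i, (ν i).factorial = s.factorial := by
  obtain ⟨f₀, h₀⟩ := mapsWithFibers_nonempty hν
  have hmaps : ∀ σ ∈ (Finset.univ : Finset (Equiv.Perm (Fin s))),
      f₀ ∘ σ ∈ mapsWithFibers s ν := fun σ _ => comp_perm_mem_mapsWithFibers σ h₀
  have key := Finset.card_eq_sum_card_fiberwise hmaps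
  rw [Finset.card_univ, Fintype.card_perm, Fintype.card_fin] at key
  rw [key, Finset.sum_const_nat]
  intro f hf
  -- two maps with equipotent fibres differ by a permutation of the source
  obtain ⟨τ, hτ⟩ : ∃ τ : Equiv.Perm (Fin s), f₀ ∘ τ = f := by
    have hc : ∀ i, Nonempty ({j // f j = i} ≃ {j // f₀ j = i}) := fun i =>
      Fintype.card_eq.1 ((mem_mapsWithFibers.1 hf i).trans (mem_mapsWithFibers.1 h₀ i).symm)
    exact ⟨Equiv.ofFiberEquiv fun i => (hc i).some,
      funext fun j => Equiv.ofFiberEquiv_map (fun i => (hc i).some) j⟩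
  have hst := DomMulAct.stabilizer_card f₀
  rw [Finset.prod_congr rfl fun i _ => by rw [mem_mapsWithFibers.1 h₀ i]] at hst
  rw [← hst, Fintype.card_subtype]
  refine Finset.card_bij (fun σ _ => σ * τ⁻¹) ?_ ?_ ?_
  · intro σ hσ
    simp only [Finset.mem_filter, Finset.mem_univ, true_and] at hσ ⊢
    funext j
    have := congrFun (hσ.trans hτ.symm) (τ⁻¹ j)
    simpa using this
  · intro a _ b _ h
    simpa using h
  · intro σ hσ
    simp only [Finset.mem_filter, Finset.mem_univ, true_and] at hσ
    refine ⟨σ * τ, ?_, by simp⟩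
    simp only [Finset.mem_filter, Finset.mem_univ, true_and]
    rw [← hτ]
    funext j
    exact congrFun hσ (τ j)

theorem sum_digits_prime_pow {p : ℕ} (hp : p.Prime) (a : ℕ) : (Nat.digits p (p ^ a)).sum = 1 := by
  induction a with
  | zero => simp [Nat.digits_of_lt p 1 one_ne_zero hp.one_lt]
  | succ a ih =>
    rw [pow_succ', Nat.digits_base_mul hp.one_lt (pow_pos hp.pos a)]
    simpa using ih

/-- Replacing `p ^ (a + 1)` by `p` copies of `p ^ a` increases the number of summands by `p - 1`;
so `s` is a sum of `digitSum p s + (p - 1) * r` powers of `p` for every admissible `r`. -/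
theorem exists_multiset_prime_pow {p : ℕ} (hp : p.Prime) (s r : ℕ)
    (hr : digitSum p s + (p - 1) * r ≤ s) :
    ∃ m : Multiset ℕ, (∀ q ∈ m, ∃ a, q = p ^ a) ∧ m.sum = s ∧
      m.card = digitSum p s + (p - 1) * r := by
  induction r with
  | zero =>
    have key : ∀ L : List ℕ, ∃ m : Multiset ℕ, (∀ q ∈ m, ∃ a, q = p ^ a) ∧
        m.sum = Nat.ofDigits p L ∧ m.card = L.sum := by
      intro L
      induction L with
      | nil => exact ⟨0, by simp⟩
      | cons c L ih =>
        obtain ⟨m, h1, h2, h3⟩ := ih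
        refine ⟨Multiset.replicate c 1 + m.map (p * ·), ?_, ?_, ?_⟩
        · intro q hq
          rw [Multiset.mem_add, Multiset.mem_map] at hq
          rcases hq with hq | ⟨q', hq', rfl⟩
          · exact ⟨0, by simpa using Multiset.eq_of_mem_replicate hq⟩
          · obtain ⟨a, rfl⟩ := h1 q' hq'
            exact ⟨a + 1, (pow_succ' p a).symm⟩
        · rw [Multiset.sum_add, Multiset.sum_map_mul_left, Multiset.map_id', h2]
          simp [Nat.ofDigits_cons]
        · simp [h3]
    obtain ⟨m, h1, h2, h3⟩ := key (Nat.digits p s)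
    exact ⟨m, h1, by rw [h2, Nat.ofDigits_digits], by simpa [digitSum] using h3⟩
  | succ r ih =>
    have hp1 := hp.two_le
    have hlt : digitSum p s + (p - 1) * r < s := by
      refine lt_of_lt_of_le ?_ hr
      rw [mul_add, mul_one]
      omega
    obtain ⟨m, h1, h2, h3⟩ := ih hlt.le
    -- not all summands are `1`, since there are fewer than `s` of them
    obtain ⟨q, hq, hq1⟩ : ∃ q ∈ m, q ≠ 1 := by
      by_contra! h
      rw [Multiset.eq_replicate_of_mem h] at h2
      simp only [Multiset.sum_replicate, smul_eq_mul, mul_one] at h2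
      omega
    obtain ⟨a, rfl⟩ := h1 q hq
    obtain ⟨a, rfl⟩ : ∃ b, a = b + 1 := Nat.exists_eq_succ_of_ne_zero (by rintro rfl; simp at hq1)
    obtain ⟨m', rfl⟩ := Multiset.exists_cons_of_mem hq
    refine ⟨Multiset.replicate p (p ^ a) + m', ?_, ?_, ?_⟩
    · intro q hq
      rcases Multiset.mem_add.1 hq with hq | hq
      · exact ⟨a, Multiset.eq_of_mem_replicate hq⟩
      · exact h1 q (Multiset.mem_cons_of_mem hq)
    · rw [← h2]; simp [pow_succ']
    · simp only [Multiset.card_add, Multiset.card_replicate, Multiset.card_cons] at h3 ⊢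
      rw [mul_add, mul_one]
      omega

/-- By Legendre's formula, a composition of `s` into `digitSum p s + (p - 1) * r` powers of `p` has
a multinomial coefficient of `p`-adic valuation `r`. -/
theorem exists_padicValNat_card_mapsWithFibers {p : ℕ} (hp : p.Prime) (s r n : ℕ)
    (hn : n = digitSum p s + (p - 1) * r) (hr : n ≤ s) :
    ∃ ν : Fin n → ℕ, (∀ i, 0 < ν i) ∧
      ∃ c, (mapsWithFibers s ν).card = p ^ r * c ∧ p.Coprime c := by
  have := Fact.mk hp
  obtain ⟨m, h1, h2, h3⟩ := exists_multiset_prime_pow hp s r (hn ▸ hr)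
  obtain ⟨ν, hmν⟩ : ∃ ν : Fin n → ℕ, Multiset.map ν Finset.univ.val = m := by
    have hl : m.toList.length = n := by rw [Multiset.length_toList, h3, hn]
    subst hl
    refine ⟨m.toList.get, ?_⟩
    rw [Fin.univ_val_map, List.ofFn_get, Multiset.coe_toList]
  have hpow : ∀ i, ∃ a, ν i = p ^ a := fun i =>
    h1 _ (hmν ▸ Multiset.mem_map_of_mem ν (Finset.mem_univ_val i))
  have hsum : ∑ i, ν i = s := by rw [← h2, ← hmν]; rfl
  have hpos : ∀ i, 0 < ν i := fun i => by
    obtain ⟨a, ha⟩ := hpow i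
    rw [ha]; exact pow_pos hp.pos a
  refine ⟨ν, hpos, ?_⟩
  have hcard := card_mapsWithFibers_mul hsum
  set N := (mapsWithFibers s ν).card with hN
  have hN0 : N ≠ 0 := (mapsWithFibers_nonempty hsum).card_ne_zero
  have hP0 : ∏ i, (ν i).factorial ≠ 0 :=
    Finset.prod_ne_zero_iff.2 fun i _ => Nat.factorial_ne_zero _
  have hv : padicValNat p N + ∑ i, padicValNat p (ν i).factorial = padicValNat p s.factorial := by
    rw [← hcard, padicValNat.mul hN0 hP0]
    congr 1
    induction (Finset.univ : Finset (Fin n)) using Finset.induction_on with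
    | empty => simp
    | insert a t ha ih =>
      rw [Finset.sum_insert ha, Finset.prod_insert ha, padicValNat.mul (Nat.factorial_ne_zero _)
        (Finset.prod_ne_zero_iff.2 fun i _ => Nat.factorial_ne_zero _), ih]
  have hν' : ∀ i, (p - 1) * padicValNat p (ν i).factorial + 1 = ν i := fun i => by
    obtain ⟨a, ha⟩ := hpow i
    rw [sub_one_mul_padicValNat_factorial, ha, sum_digits_prime_pow hp]
    exact Nat.sub_add_cancel (pow_pos hp.pos a)
  have hs' : (p - 1) * padicValNat p s.factorial + digitSum p s = s := by
    rw [sub_one_mul_padicValNat_factorial]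
    exact Nat.sub_add_cancel (Nat.digit_sum_le p s)
  have hsn : (p - 1) * ∑ i, padicValNat p (ν i).factorial + n = s := by
    conv_rhs => rw [← hsum, ← Finset.sum_congr rfl fun i _ => hν' i]
    rw [Finset.sum_add_distrib, ← Finset.mul_sum]
    simp
  have hval : padicValNat p N = r := by
    have h : (p - 1) * padicValNat p N = (p - 1) * r := by
      rw [← hv, mul_add] at hs'
      omega
    exact Nat.eq_of_mul_eq_mul_left (by have := hp.two_le; omega) h
  obtain ⟨c, hc⟩ := pow_padicValNat_dvd (p := p) (n := N)
  rw [hval] at hc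
  refine ⟨c, hc, (hp.coprime_iff_not_dvd).2 ?_⟩
  rintro ⟨c', rfl⟩
  have h2 : p ^ (r + 1) ∣ N := ⟨c', by rw [hc, pow_succ]; ring⟩
  rw [padicValNat_dvd_iff_le hN0, hval] at h2
  omega

theorem digitSum_pos {p s : ℕ} (hs : 0 < s) : 0 < digitSum p s := by
  by_contra! h
  have h0 : (Nat.digits p s).sum = 0 := Nat.le_zero.1 h
  have : Nat.ofDigits p (Nat.digits p s) = 0 := by
    rw [List.eq_replicate_of_mem (List.sum_eq_zero_iff.1 h0)]
    induction (Nat.digits p s).length with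
    | zero => simp
    | succ n ih => simp [List.replicate_succ, Nat.ofDigits_cons, ih]
  rw [Nat.ofDigits_digits] at this
  omega

theorem modEq_digitSum {p : ℕ} (hp : p.Prime) (s : ℕ) : s ≡ digitSum p s [MOD p - 1] := by
  rcases hp.two_le.eq_or_lt with rfl | h
  · exact Nat.modEq_one
  · exact Nat.modEq_digits_sum (p - 1) p (by
      obtain ⟨k, rfl⟩ : ∃ k, p = k + 3 := ⟨p - 3, by omega⟩
      simp only [show k + 3 - 1 = k + 2 by omega]
      rw [show k + 3 = 1 + (k + 2) by ring, Nat.add_mod_right]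
      exact Nat.mod_eq_of_lt (by omega)) s

/-- `digitSum p s + (p - 1) * torsionExponent p s d` is the least integer that is at least
`digitSum p s`, larger than `d`, and congruent to `s` modulo `p - 1`; it is at most `s`. -/
theorem torsionExponent_bounds {p s : ℕ} (hp : p.Prime) (d : WithBot ℕ)
    (hds : d < (s : WithBot ℕ)) :
    d < ((digitSum p s + (p - 1) * torsionExponent p s d : ℕ) : WithBot ℕ) ∧
      digitSum p s + (p - 1) * torsionExponent p s d ≤ s := by
  have hle : digitSum p s ≤ s := Nat.digit_sum_le p s
  cases d with
  | bot => exact ⟨WithBot.bot_lt_coe _, by simpa [torsionExponent] using hle⟩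
  | coe d =>
    have hds' : d < s := WithBot.coe_lt_coe.1 hds
    have hp1 : 1 < p := hp.one_lt
    have hq : (0 : ℚ) < (p : ℚ) - 1 := by
      have : (1 : ℚ) < p := by exact_mod_cast hp1
      linarith
    have hcast : ((p - 1 : ℕ) : ℚ) = (p : ℚ) - 1 := by push_cast [hp1.le]; ring
    set x : ℚ := ((d : ℚ) + 1 - (digitSum p s : ℚ)) / ((p : ℚ) - 1) with hx
    have hr : torsionExponent p s (d : WithBot ℕ) = ⌈x⌉.toNat := rfl
    generalize torsionExponent p s (d : WithBot ℕ) = r at hr ⊢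
    have h1 : x ≤ (r : ℚ) := by
      have h : ((⌈x⌉ : ℤ) : ℚ) ≤ ((⌈x⌉.toNat : ℤ) : ℚ) := Int.cast_le.2 (Int.self_le_toNat ⌈x⌉)
      rw [hr]
      exact (Int.le_ceil x).trans (h.trans_eq (Int.cast_natCast _))
    constructor
    · rw [hx, div_le_iff₀ hq] at h1
      have : ((d + 1 : ℕ) : ℚ) ≤ ((digitSum p s + (p - 1) * r : ℕ) : ℚ) := by
        rw [Nat.cast_add, Nat.cast_add, Nat.cast_mul, hcast]
        push_cast
        linarith
      have h2 : d + 1 ≤ digitSum p s + (p - 1) * r := by exact_mod_cast this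
      exact WithBot.coe_lt_coe.2 h2
    · obtain ⟨k, hk⟩ := (Nat.modEq_iff_dvd' hle).1 (modEq_digitSum hp s).symm
      have hrk : r ≤ k := by
        rw [hr, Int.toNat_le]
        refine Int.ceil_le.2 ?_
        rw [hx, div_le_iff₀ hq]
        have h3 : d + 1 ≤ digitSum p s + (p - 1) * k := by omega
        have h4 : ((d + 1 : ℕ) : ℚ) ≤ ((digitSum p s + (p - 1) * k : ℕ) : ℚ) := by exact_mod_cast h3
        rw [Nat.cast_add, Nat.cast_add, Nat.cast_mul, hcast] at h4
        push_cast at h4 ⊢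
        linarith
      have := Nat.mul_le_mul_left (p - 1) hrk
      omega

/-! ### Naturality of the maps induced on Ext by exact functors -/

section Ext

open Abelian

variable {C : Type*} [Category* C] [Abelian C] [HasExt.{w} C]

/-- Every class of positive degree is the composite of a class of one degree less with the class of
an extension. -/
theorem exists_comp_extClass_eq [EnoughInjectives C] {X Y : C} {n : ℕ} (x : Ext.{w} X Y (n + 1)) :
    ∃ (I Q : C) (f : Y ⟶ I) (g : I ⟶ Q) (zero : f ≫ g = 0)
      (hS : (ShortComplex.mk f g zero).ShortExact) (y : Ext.{w} X Q n),
      y.comp hS.extClass rfl = x := by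
  let S := ShortComplex.mk (Injective.ι Y) (Limits.cokernel.π (Injective.ι Y))
    (Limits.cokernel.condition _)
  have hS : S.ShortExact := { exact := ShortComplex.exact_cokernel _ }
  obtain ⟨y, hy⟩ := Ext.covariant_sequence_exact₁ X hS x (Ext.eq_zero_of_injective _) rfl
  exact ⟨_, _, _, _, _, hS, y, hy⟩

variable {Φ Ψ : C ⥤ C} [Φ.Additive] [Limits.PreservesFiniteLimits Φ]
  [Limits.PreservesFiniteColimits Φ] [Ψ.Additive] [Limits.PreservesFiniteLimits Ψ]
  [Limits.PreservesFiniteColimits Ψ]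

/-- The maps induced on `Ext` by exact functors are natural in the functor. Dimension shifting
along an embedding of `Y` into an injective object reduces this to degree `0`. -/
theorem mapExactFunctor_naturality [EnoughInjectives C] (τ : Φ ⟶ Ψ) {X Y : C} {n : ℕ}
    (x : Ext.{w} X Y n) :
    (x.mapExactFunctor Φ).comp (Ext.mk₀ (τ.app Y)) (add_zero n) =
      (Ext.mk₀ (τ.app X)).comp (x.mapExactFunctor Ψ) (zero_add n) := by
  induction n generalizing Y with
  | zero =>
    obtain ⟨f, rfl⟩ := (Ext.mk₀_bijective X Y).2 x
    simp only [Ext.mapExactFunctor_mk₀, Ext.mk₀_comp_mk₀, τ.naturality]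
  | succ n ih =>
    obtain ⟨I, Q, f, g, zero, hS, y, rfl⟩ := exists_comp_extClass_eq x
    let δ : Ext.{w} Q Y 1 := hS.extClass
    have h : (δ.mapExactFunctor Φ).comp (Ext.mk₀ (τ.app Y)) (add_zero 1) =
        (Ext.mk₀ (τ.app Q)).comp (δ.mapExactFunctor Ψ) (zero_add 1) := by
      have h' := ShortComplex.ShortExact.extClass_naturality (hS.map_of_exact Φ)
        (hS.map_of_exact Ψ) ((ShortComplex.mk f g zero).mapNatTrans τ)
      rw [← Ext.mapExactFunctor_extClass, ← Ext.mapExactFunctor_extClass] at h'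
      exact h'
    change ((y.comp δ rfl).mapExactFunctor Φ).comp _ _ =
      (Ext.mk₀ (τ.app X)).comp ((y.comp δ rfl).mapExactFunctor Ψ) _
    rw [Ext.mapExactFunctor_comp, Ext.mapExactFunctor_comp, Ext.comp_assoc_of_third_deg_zero, h,
      ← Ext.comp_assoc_of_second_deg_zero, ih y, Ext.comp_assoc _ _ _ (zero_add n) rfl (by omega)]

theorem mapExactFunctor_id [EnoughInjectives C] {X Y : C} {n : ℕ} (x : Ext.{w} X Y n) :
    x.mapExactFunctor (𝟭 C) = x := by
  induction n generalizing Y with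
  | zero =>
    obtain ⟨f, rfl⟩ := (Ext.mk₀_bijective X Y).2 x
    exact Ext.mapExactFunctor_mk₀ _ _
  | succ n ih =>
    obtain ⟨I, Q, f, g, zero, hS, y, rfl⟩ := exists_comp_extClass_eq x
    rw [Ext.mapExactFunctor_comp, Ext.mapExactFunctor_extClass, ih y]
    rfl

theorem Ext.zsmul_comp_mk₀ {X Y : C} {n : ℕ} (x : Ext.{w} X Y n) (m : ℤ) :
    x.comp (Ext.mk₀ (m • 𝟙 Y)) (add_zero n) = m • x := by
  have h1 := map_zsmul (Ext.addEquiv₀ (X := Y) (Y := Y)).symm m (𝟙 Y)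
  have h2 := map_zsmul (Ext.bilinearComp X Y Y n 0 n (add_zero n) x) m (Ext.mk₀ (𝟙 Y))
  change Ext.mk₀ (m • 𝟙 Y) = m • Ext.mk₀ (𝟙 Y) at h1
  rw [h1]
  exact h2.trans (congrArg _ (Ext.comp_mk₀_id x))

theorem Ext.mk₀_zsmul_comp {X Y : C} {n : ℕ} (x : Ext.{w} X Y n) (m : ℤ) :
    (Ext.mk₀ (m • 𝟙 X)).comp x (zero_add n) = m • x := by
  have h1 := map_zsmul (Ext.addEquiv₀ (X := X) (Y := X)).symm m (𝟙 X)
  have h2 := map_zsmul ((Ext.bilinearComp X X Y 0 n n (zero_add n)).flip x) m (Ext.mk₀ (𝟙 X))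
  change Ext.mk₀ (m • 𝟙 X) = m • Ext.mk₀ (𝟙 X) at h1
  rw [h1]
  exact h2.trans (congrArg _ (Ext.mk₀_id_comp x))

variable [EnoughInjectives C]

/-- If `τ : 𝟭 ⟶ Φ` vanishes on `X` and is a divisor of `m` on `Y`, then `m` kills `Ext X Y`. -/
theorem zsmul_ext_eq_zero_of_unit (τ : 𝟭 C ⟶ Φ) {X Y : C} (hX : τ.app X = 0) {m : ℤ}
    (β : Φ.obj Y ⟶ Y) (hβ : τ.app Y ≫ β = m • 𝟙 Y) {n : ℕ} (x : Ext.{w} X Y n) : m • x = 0 := by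
  have h := mapExactFunctor_naturality τ x
  rw [mapExactFunctor_id, hX, Ext.mk₀_zero, Ext.zero_comp] at h
  have h2 := Ext.mk₀_comp_mk₀ (τ.app Y) β
  rw [hβ] at h2
  rw [← Ext.zsmul_comp_mk₀, ← h2]
  refine (Ext.comp_assoc_of_third_deg_zero _ _ _ _).symm.trans ?_
  exact (congrArg (fun z => Ext.comp z (Ext.mk₀ β) (add_zero n)) h).trans (Ext.zero_comp _ _ _ _ _)

/-- If `τ : Φ ⟶ 𝟭` vanishes on `Y` and is a divisor of `m` on `X`, then `m` kills `Ext X Y`. -/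
theorem zsmul_ext_eq_zero_of_counit (τ : Φ ⟶ 𝟭 C) {X Y : C} (hY : τ.app Y = 0) {m : ℤ}
    (α : X ⟶ Φ.obj X) (hα : α ≫ τ.app X = m • 𝟙 X) {n : ℕ} (x : Ext.{w} X Y n) : m • x = 0 := by
  have h := mapExactFunctor_naturality τ x
  rw [mapExactFunctor_id, hY, Ext.mk₀_zero, Ext.comp_zero] at h
  have h2 := Ext.mk₀_comp_mk₀ α (τ.app X)
  rw [hα] at h2
  rw [← Ext.mk₀_zsmul_comp, ← h2]
  refine (Ext.comp_assoc _ _ _ (zero_add 0) (zero_add n) (by omega)).trans ?_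
  exact (congrArg (fun z => Ext.comp (Ext.mk₀ α) z (zero_add n)) h.symm).trans
    (Ext.comp_zero _ _ _ _ _)

/-- If `τ : 𝟭 ⟶ 𝟭` acts by `m` on `X` and by `k` on `Y`, then `m` and `k` agree on `Ext X Y`. -/
theorem zsmul_ext_eq_zsmul (τ : 𝟭 C ⟶ 𝟭 C) {X Y : C} {m k : ℤ} (hX : τ.app X = m • 𝟙 X)
    (hY : τ.app Y = k • 𝟙 Y) {n : ℕ} (x : Ext.{w} X Y n) : k • x = m • x := by
  have h := mapExactFunctor_naturality τ x
  rw [mapExactFunctor_id, hX, hY] at h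
  exact (Ext.zsmul_comp_mk₀ x k).symm.trans (h.trans (Ext.mk₀_zsmul_comp x m))

end Ext

variable {R : Type u} [CommRing R]

/-! ### Iterated differences and cross effects -/

/-- The alternating sum `∑_{S ⊆ T} (-1)^|S| H(∑_{i ∈ S} g i)`: up to sign, the iterated difference
of the function `f ↦ H(f)` at `0` in the directions `g i`. -/
noncomputable def altSum {ι : Type*} (H : VR R ⥤ ModuleCat.{v} R) {X Z : VR R} (T : Finset ι)
    (g : ι → (X ⟶ Z)) : H.obj X ⟶ H.obj Z :=
  ∑ S ∈ T.powerset, (-1 : ℤ) ^ S.card • H.map (∑ i ∈ S, g i)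

theorem altSum_apply {ι : Type*} (H : VR R ⥤ ModuleCat.{v} R) {X Z : VR R} (T : Finset ι)
    (g : ι → (X ⟶ Z)) (y : H.obj X) :
    (altSum H T g).hom y = ∑ S ∈ T.powerset, (-1 : ℤ) ^ S.card • (H.map (∑ i ∈ S, g i)).hom y := by
  simp only [altSum, ModuleCat.hom_sum, ModuleCat.hom_zsmul, LinearMap.sum_apply,
    LinearMap.smul_apply]

/-- The iterated differences of order `n` of `f ↦ H(f)` at `0` vanish. -/
def VanishingAltSums (H : VR R ⥤ ModuleCat.{v} R) (n : ℕ) : Prop :=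
  ∀ ⦃ι : Type⦄ (X Z : VR R) (T : Finset ι) (g : ι → (X ⟶ Z)), T.card = n → altSum H T g = 0

/-- The alternating sums are natural in the functor. -/
theorem altSum_naturality {ι : Type*} {K H : VR R ⥤ ModuleCat.{v} R} (φ : K ⟶ H) {X Z : VR R}
    (T : Finset ι) (g : ι → (X ⟶ Z)) : altSum K T g ≫ φ.app Z = φ.app X ≫ altSum H T g := by
  simp only [altSum, Preadditive.sum_comp, Preadditive.comp_sum, Preadditive.zsmul_comp,
    Preadditive.comp_zsmul, NatTrans.naturality]

/-- The inclusion of the reduced part. -/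
def reducedPartIncl (F : VR R ⥤ ModuleCat.{v} R) : reducedPart F ⟶ F where
  app _ := ModuleCat.ofHom (Submodule.subtype _)
  naturality _ _ _ := rfl

/-- The inclusion of the deviation of `H` into the functor `X ↦ H(X ⊕ Y)`. -/
def deviationIncl (H : VR R ⥤ ModuleCat.{v} R) (Y : VR R) : deviation H Y ⟶ VR.addRight Y ⋙ H where
  app _ := ModuleCat.ofHom (Submodule.subtype _)
  naturality _ _ _ := rfl

theorem sum_map_app_eq_zero {ι : Type*} {K H : VR R ⥤ ModuleCat.{v} R} (φ : K ⟶ H) {X Z : VR R}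
    {T : Finset ι} {g : ι → (X ⟶ Z)} (h : altSum K T g = 0) (y : K.obj X) :
    ∑ A ∈ T.powerset, (-1 : ℤ) ^ A.card • (H.map (∑ i ∈ A, g i)).hom ((φ.app X).hom y) = 0 := by
  rw [← altSum_apply, ← ModuleCat.comp_apply, ← altSum_naturality, h, Limits.zero_comp]
  rfl

theorem sum_powerset_insert_neg_one {A : Type*} [AddCommGroup A] {ι : Type*} [DecidableEq ι]
    {a : ι} {T : Finset ι} (ha : a ∉ T) (φ : Finset ι → A) :
    ∑ S ∈ (insert a T).powerset, (-1 : ℤ) ^ S.card • φ S =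
      ∑ S ∈ T.powerset, (-1 : ℤ) ^ S.card • (φ S - φ (insert a S)) := by
  rw [Finset.sum_powerset_insert ha, ← Finset.sum_add_distrib]
  refine Finset.sum_congr rfl fun S hS => ?_
  have haS : a ∉ S := fun h => ha (Finset.mem_powerset.1 hS h)
  rw [Finset.card_insert_of_notMem haS, pow_succ, mul_neg_one, neg_smul, smul_sub, sub_eq_add_neg]

theorem sum_powerset_neg_one_smul_const {A : Type*} [AddCommGroup A] {ι : Type*}
    {T : Finset ι} (hT : T.card ≠ 0) (a : A) :
    ∑ S ∈ T.powerset, (-1 : ℤ) ^ S.card • a = 0 := by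
  rw [← Finset.sum_smul, Finset.sum_powerset_neg_one_pow_card_of_nonempty
    (Finset.card_ne_zero.1 hT), zero_smul]

/-- If the deviations of `H` have vanishing differences of order `n ≥ 1`, then `H` has vanishing
differences of order `n + 1`: the mixed difference
`H(f, h) - H(f, 0) - H(0, h) + H(0, 0)` of an element of `H(X)` lies in the deviation of `H` and
is natural in `f`. -/
theorem vanishingAltSums_succ (H : VR R ⥤ ModuleCat.{v} R) (n : ℕ) (hn : n ≠ 0)
    (h : ∀ Y, VanishingAltSums (deviation H Y) n) : VanishingAltSums H (n + 1) := by
  classical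
  intro ι X Z T g hT'
  obtain ⟨a, T, ha, rfl, hT⟩ := Finset.card_eq_succ.1 hT'
  apply ModuleCat.hom_ext
  ext y
  rw [altSum_apply, sum_powerset_insert_neg_one ha fun S => (H.map (∑ i ∈ S, g i)).hom y]
  -- the map `(f, k)` into a direct sum
  let pr : ∀ {W W' : VR R} (_ : X ⟶ W) (_ : X ⟶ W'), X ⟶ W.sum W' := fun f k =>
    VR.ofHom (N := VR.sum _ _) ((VR.lin f).prod (VR.lin k))
  let z : ∀ {W : VR R} (_ : X ⟶ W), H.obj (W.sum Z) := fun f =>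
    (H.map (pr f (g a))).hom y - (H.map (pr f (0 : X ⟶ Z))).hom y -
      (H.map (pr 0 (g a))).hom y + (H.map (pr 0 (0 : X ⟶ Z))).hom y
  have hcomp : ∀ {U V W : VR R} (p : U ⟶ V) (q : V ⟶ W) (x : H.obj U),
      (H.map q).hom ((H.map p).hom x) = (H.map (p ≫ q)).hom x := fun p q x => by
    rw [H.map_comp]; rfl
  have hz : ∀ {W : VR R} (f : X ⟶ W), z f ∈ LinearMap.ker (H.map (VR.fst W Z)).hom ⊓
      LinearMap.ker (H.map (VR.snd W Z)).hom := by
    intro W f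
    have e1 : ∀ (f : X ⟶ W) (k : X ⟶ Z), pr f k ≫ VR.fst W Z = f := fun _ _ => rfl
    have e2 : ∀ (f : X ⟶ W) (k : X ⟶ Z), pr f k ≫ VR.snd W Z = k := fun _ _ => rfl
    constructor
    · simp only [z, SetLike.mem_coe, LinearMap.mem_ker, map_add, map_sub, hcomp, e1]
      abel
    · simp only [z, SetLike.mem_coe, LinearMap.mem_ker, map_add, map_sub, hcomp, e2]
      abel
  let z₁ : (deviation H Z).obj X := ⟨z (𝟙 X), hz (𝟙 X)⟩
  have hnat : ∀ f : X ⟶ Z, (((deviation H Z).map f).hom z₁).1 = z f := by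
    intro f
    have e3 : ∀ k : X ⟶ Z, pr (𝟙 X) k ≫ VR.sumMap f Z = pr f k := fun _ => rfl
    have e4 : ∀ k : X ⟶ Z, pr (0 : X ⟶ X) k ≫ VR.sumMap f Z = pr (0 : X ⟶ Z) k := by
      intro k
      apply ObjectProperty.hom_ext; apply ModuleCat.hom_ext; apply LinearMap.ext; intro x
      exact Prod.ext (map_zero (VR.lin f)) rfl
    change (H.map (VR.sumMap f Z)).hom (z (𝟙 X)) = z f
    simp only [z, map_add, map_sub, hcomp, e3, e4]
  have key : ∑ S ∈ T.powerset, (-1 : ℤ) ^ S.card • z (∑ i ∈ S, g i) = 0 := by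
    refine Eq.trans ?_ (sum_map_app_eq_zero (deviationIncl H Z) (h Z X Z T g hT) z₁)
    exact Finset.sum_congr rfl fun S _ => congrArg _ (hnat _).symm
  let fold : Z.sum Z ⟶ Z := VR.ofHom (M := Z.sum Z) (LinearMap.id.coprod LinearMap.id)
  have hfold : ∀ f k : X ⟶ Z, pr f k ≫ fold = f + k := fun f k => by
    apply ObjectProperty.hom_ext; apply ModuleCat.hom_ext; apply LinearMap.ext; intro x
    rfl
  have key2 := congrArg (H.map fold).hom key
  simp only [map_sum, map_zsmul, z, map_add, map_sub, hcomp, hfold, map_zero, add_zero,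
    zero_add] at key2
  have hc := sum_powerset_neg_one_smul_const (T := T) (by omega)
    ((H.map (0 : X ⟶ Z)).hom y - (H.map (g a)).hom y)
  change _ = (0 : H.obj Z)
  rw [← neg_eq_zero, ← Finset.sum_neg_distrib, ← key2, ← add_zero (Finset.sum _ _), ← hc,
    ← Finset.sum_add_distrib, ← sub_eq_zero, ← Finset.sum_sub_distrib]
  refine Finset.sum_eq_zero fun S hS => ?_
  have haS : a ∉ S := fun h => ha (Finset.mem_powerset.1 hS h)
  rw [Finset.sum_insert haS, add_comm (g a), ← smul_neg, ← smul_add, ← smul_sub]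
  refine (congrArg _ ?_).trans (smul_zero _)
  abel

theorem DegreeLE.succ {F : VR R ⥤ ModuleCat.{v} R} {d : ℕ} (h : DegreeLE F d) :
    DegreeLE F (d + 1) := by
  rintro (_ | ⟨Y, L⟩) hL X
  · simp at hL
  · have : Subsingleton ((crossEffect F L).obj (X.sum Y)) := h L (by simpa using hL) _
    exact Function.Injective.subsingleton (β := (crossEffect F L).obj (X.sum Y))
      Subtype.val_injective

theorem DegreeLE.mono {F : VR R ⥤ ModuleCat.{v} R} {d e : ℕ} (h : DegreeLE F d) (hde : d ≤ e) :
    DegreeLE F e := by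
  induction e, hde using Nat.le_induction with
  | base => exact h
  | succ e _ ih => exact ih.succ

/-- A functor of degree at most `d` has vanishing differences of order `d + 1`: the zero functor
`Cr_{d + 1} F` has vanishing differences of order `1`, and undoing each of the `d` deviations raises
the order by one. -/
theorem DegreeLE.vanishingAltSums {F : VR R ⥤ ModuleCat.{v} R} {d : ℕ} (h : DegreeLE F d) :
    VanishingAltSums F (d + 1) := by
  have key : ∀ k (L : List (VR R)), L.length + k = d →
      VanishingAltSums (crossEffect F L) (k + 1) := by
    intro k
    induction k with
    | zero =>
      intro L hL ι X Z T g _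
      have := h L hL X
      apply ModuleCat.hom_ext; ext y
      rw [Subsingleton.elim y 0, map_zero, map_zero]
    | succ k ih =>
      intro L hL
      exact vanishingAltSums_succ _ _ (Nat.succ_ne_zero k) fun Y => ih (Y :: L) (by
        rw [List.length_cons]; omega)
  have h₀ := key d [] (by simp)
  intro ι X Z T g hT
  apply ModuleCat.hom_ext; ext y
  have hcomp : ∀ {U V W : VR R} (p : U ⟶ V) (q : V ⟶ W) (x : F.obj U),
      (F.map q).hom ((F.map p).hom x) = (F.map (p ≫ q)).hom x := fun p q x => by
    rw [F.map_comp]; rfl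
  have hy : y - (F.map (0 : X ⟶ X)).hom y ∈
      LinearMap.ker (F.map (0 : X ⟶ VR.zero R)).hom := by
    rw [LinearMap.mem_ker, map_sub, hcomp, Limits.zero_comp, sub_self]
  have h1 := sum_map_app_eq_zero (reducedPartIncl F) (h₀ X Z T g hT) ⟨_, hy⟩
  have hc := sum_powerset_neg_one_smul_const (T := T) (by omega) ((F.map (0 : X ⟶ Z)).hom y)
  rw [altSum_apply]
  refine Eq.trans ?_ h1
  rw [← sub_zero (Finset.sum _ _), ← hc, ← Finset.sum_sub_distrib]
  refine Finset.sum_congr rfl fun S _ => ?_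
  rw [← smul_sub]
  have e : (F.map (∑ i ∈ S, g i)).hom (y - (F.map (0 : X ⟶ X)).hom y) =
      (F.map (∑ i ∈ S, g i)).hom y - (F.map (0 : X ⟶ Z)).hom y := by
    rw [map_sub, hcomp, Limits.zero_comp]
  exact congrArg _ e.symm

theorem HasDegree.degreeLE {F : VR R ⥤ ModuleCat.{v} R} {d : WithBot ℕ} (h : HasDegree F d) {n : ℕ}
    (hn : d < ((n + 1 : ℕ) : WithBot ℕ)) : DegreeLE F n := by
  rcases d with _ | _ | d
  · have : DegreeLE F 0 := by
      intro L hL X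
      obtain rfl := List.length_eq_zero_iff.1 hL
      have : Subsingleton (F.obj X) := h X
      exact Subtype.val_injective.subsingleton
    exact this.mono (Nat.zero_le n)
  · exact h.1.mono (Nat.zero_le n)
  · exact h.1.mono (Nat.le_of_lt_succ (WithBot.coe_lt_coe.1 hn))

/-! ### Tensor powers of sums and the Schur category -/

theorem sum_powerset_neg_one_of_subset {ι : Type*} [DecidableEq ι] {U T : Finset ι} (hU : U ⊆ T) :
    ∑ S ∈ T.powerset, (if U ⊆ S then (-1 : ℤ) ^ S.card else 0) =
      if U = T then (-1 : ℤ) ^ T.card else 0 := by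
  have h1 : T.powerset.filter (U ⊆ ·) = (T \ U).powerset.image (U ∪ ·) := by
    rw [← Finset.Icc_eq_image_powerset hU]
    ext S
    simp [and_comm]
  rw [← Finset.sum_filter, h1, Finset.sum_image]
  · have h2 : ∀ S ∈ (T \ U).powerset, (-1 : ℤ) ^ (U ∪ S).card = (-1) ^ U.card * (-1) ^ S.card := by
      intro S hS
      rw [Finset.card_union_of_disjoint, pow_add]
      exact (Finset.disjoint_of_subset_left (Finset.mem_powerset.1 hS) Finset.sdiff_disjoint).symm
    rw [Finset.sum_congr rfl h2, ← Finset.mul_sum, Finset.sum_powerset_neg_one_pow_card]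
    by_cases h : U = T
    · simp [h]
    · have : ¬ T ⊆ U := fun h' => h (hU.antisymm h')
      simp [h, this]
  · intro A hA B hB h
    have hA' := Finset.mem_powerset.1 hA
    have hB' := Finset.mem_powerset.1 hB
    have hd : ∀ C ⊆ T \ U, (U ∪ C) \ U = C := fun C hC => by
      rw [Finset.union_sdiff_left]
      exact Finset.sdiff_eq_self_of_disjoint
        (Finset.disjoint_of_subset_left hC Finset.sdiff_disjoint)
    rw [← hd A hA', ← hd B hB']
    exact congrArg (· \ U) h

/-- Inclusion-exclusion: the alternating sum of the tensor powers of the partial sums of the `a i`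
keeps exactly those terms of the expansion of `(∑ i ∈ T, a i) ^ ⊗ s` in which every `a i`
occurs. -/
theorem sum_powerset_map_sum {ι : Type*} [DecidableEq ι] {M N : Type*} [AddCommGroup M]
    [Module R M] [AddCommGroup N] [Module R N] (s : ℕ) (T : Finset ι) (a : ι → (M →ₗ[R] N)) :
    ∑ S ∈ T.powerset, (-1 : R) ^ S.card •
        PiTensorProduct.map (fun _ : Fin s => ∑ i ∈ S, a i) =
      (-1 : R) ^ T.card • ∑ r ∈ Fintype.piFinset (fun _ : Fin s => T) with
        Finset.univ.image r = T, PiTensorProduct.map (fun j => a (r j)) := by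
  have h1 : ∀ S ∈ T.powerset,
      (-1 : R) ^ S.card • PiTensorProduct.map (fun _ : Fin s => ∑ i ∈ S, a i) =
      ∑ r ∈ Fintype.piFinset (fun _ : Fin s => T),
        if Finset.univ.image r ⊆ S then
          (-1 : R) ^ S.card • PiTensorProduct.map (fun j => a (r j)) else 0 := by
    intro S hS
    have h := (PiTensorProduct.mapMultilinear R (fun _ : Fin s => M)
      (fun _ : Fin s => N)).map_sum_finset (fun _ i => a i) (fun _ => S)
    simp only [PiTensorProduct.mapMultilinear_apply] at h
    rw [h, ← Finset.sum_filter, Finset.smul_sum]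
    refine Finset.sum_congr ?_ fun _ _ => rfl
    ext r
    simp only [Fintype.mem_piFinset, Finset.mem_filter, Finset.image_subset_iff, Finset.mem_univ,
      true_imp_iff]
    exact ⟨fun h => ⟨fun j => Finset.mem_powerset.1 hS (h j), h⟩, fun h => h.2⟩
  rw [Finset.sum_congr rfl h1, Finset.sum_comm, Finset.smul_sum, Finset.sum_filter]
  refine Finset.sum_congr rfl fun r hr => ?_
  have hr' : Finset.univ.image r ⊆ T :=
    Finset.image_subset_iff.2 fun j _ => Fintype.mem_piFinset.1 hr j
  have h2 := congrArg (fun c : ℤ => (c : R) • PiTensorProduct.map (fun j => a (r j)))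
    (sum_powerset_neg_one_of_subset hr')
  simpa only [Int.cast_sum, Int.cast_ite, Int.cast_pow, Int.cast_neg, Int.cast_one, Int.cast_zero,
    Finset.sum_smul, ite_smul, zero_smul] using h2

/-- The linear map `M^{⊗ s} → N^{⊗ s}` underlying a morphism of the Schur category. -/
def schurVal (s : ℕ) (M N : VR R) :
    ((gammaFunctor R s).obj M ⟶ (gammaFunctor R s).obj N) →ₗ[R]
      ((⨂[R] _ : Fin s, M.obj) →ₗ[R] (⨂[R] _ : Fin s, N.obj)) :=
  (equivariantMaps s M N).subtype

theorem schurVal_injective (s : ℕ) (M N : VR R) : Function.Injective (schurVal s M N) :=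
  Subtype.val_injective

theorem schurVal_comp {s : ℕ} {M N K : VR R}
    (f : (gammaFunctor R s).obj M ⟶ (gammaFunctor R s).obj N)
    (g : (gammaFunctor R s).obj N ⟶ (gammaFunctor R s).obj K) :
    schurVal s M K (f ≫ g) = schurVal s N K g ∘ₗ schurVal s M N f := rfl

theorem schurVal_id (s : ℕ) (M : VR R) :
    schurVal s M M (𝟙 ((gammaFunctor R s).obj M)) = LinearMap.id := rfl

theorem schurVal_map {s : ℕ} {M N : VR R} (f : M ⟶ N) :
    schurVal s M N ((gammaFunctor R s).map f) = PiTensorProduct.map fun _ => VR.lin f := rfl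

theorem VR.lin_sum {ι : Type*} {M N : VR R} (S : Finset ι) (g : ι → (M ⟶ N)) :
    VR.lin (∑ i ∈ S, g i) = ∑ i ∈ S, VR.lin (g i) := by
  let φ : (M ⟶ N) →+ (M.obj →ₗ[R] N.obj) :=
    { toFun := VR.lin, map_zero' := rfl, map_add' := fun _ _ => rfl }
  exact map_sum φ g S

/-- The alternating sum `∑_{S ⊆ T} (-1)^|S| (∑_{i ∈ S} g i)^{⊗ s}`. -/
noncomputable def schurAltSum (s : ℕ) {ι : Type*} {M N : VR R} (T : Finset ι) (g : ι → (M ⟶ N)) :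
    (gammaFunctor R s).obj M ⟶ (gammaFunctor R s).obj N :=
  ∑ S ∈ T.powerset, (-1 : ℤ) ^ S.card • (gammaFunctor R s).map (∑ i ∈ S, g i)

theorem val_schurAltSum {s : ℕ} {ι : Type*} [DecidableEq ι] {M N : VR R} (T : Finset ι)
    (g : ι → (M ⟶ N)) :
    schurVal s M N (schurAltSum s T g) =
      (-1 : R) ^ T.card • ∑ r ∈ Fintype.piFinset (fun _ : Fin s => T) with
        Finset.univ.image r = T, PiTensorProduct.map (fun j => VR.lin (g (r j))) := by
  rw [schurAltSum, map_sum]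
  refine Eq.trans ?_ (sum_powerset_map_sum s T fun i => VR.lin (g i))
  refine Finset.sum_congr rfl fun S _ => ?_
  rw [← Int.cast_smul_eq_zsmul R, map_smul, ← VR.lin_sum, schurVal_map, Int.cast_pow,
    Int.cast_neg, Int.cast_one]

theorem StrictPoly.altSum_underlying {s : ℕ} (G : StrictPoly.{u, v} R s) {ι : Type*} {M N : VR R}
    (T : Finset ι) (g : ι → (M ⟶ N)) :
    altSum G.underlying T g = G.toFunctor.map (schurAltSum s T g) := by
  have := G.additive
  rw [schurAltSum, Functor.map_sum]
  simp only [Functor.map_zsmul]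
  rfl

/-- A functor of weight `s` is polynomial of degree at most `s`, since a map from a set with `s`
elements to a larger set is not surjective. -/
theorem StrictPoly.vanishingAltSums {s n : ℕ} (G : StrictPoly.{u, v} R s) (hn : s < n) :
    VanishingAltSums G.underlying n := by
  classical
  intro ι M N T g hT
  have := G.additive
  rw [StrictPoly.altSum_underlying]
  refine (congrArg G.toFunctor.map ?_).trans (G.toFunctor.map_zero _ _)
  apply schurVal_injective
  rw [val_schurAltSum, map_zero, Finset.sum_eq_zero, smul_zero]
  intro r hr
  have h1 : (Finset.univ.image r).card ≤ s := Finset.card_image_le.trans (by simp)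
  rw [(Finset.mem_filter.1 hr).2] at h1
  omega

/-- Permuting the tensor factors permutes the maps with prescribed fibre cardinalities. -/
theorem sum_mapsWithFibers_mem_equivariantMaps {s n : ℕ} (ν : Fin n → ℕ) {M N : VR R}
    (b : Fin n → (M ⟶ N)) :
    ∑ f ∈ mapsWithFibers s ν, PiTensorProduct.map (fun j => VR.lin (b (f j))) ∈
      equivariantMaps s M N := by
  intro σ x
  induction x using PiTensorProduct.induction_on with
  | add x y hx hy => simp only [map_add, hx, hy]
  | smul_tprod c m =>
    simp only [map_smul, LinearMap.sum_apply, map_sum, PiTensorProduct.reindex_tprod,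
      PiTensorProduct.map_tprod]
    congr 1
    refine Finset.sum_bij' (fun f _ => f ∘ σ) (fun f _ => f ∘ σ.symm)
      (fun f hf => comp_perm_mem_mapsWithFibers σ hf)
      (fun f hf => comp_perm_mem_mapsWithFibers σ.symm hf) ?_ ?_ ?_
    · intro f _; funext j; simp
    · intro f _; funext j; simp
    · intro f _
      refine congrArg _ (funext fun j => ?_)
      simp

/-- The component of multidegree `ν` of `(∑ i, b i) ^ ⊗ s`, as a morphism of the Schur category. -/
noncomputable def schurComponent {s n : ℕ} (ν : Fin n → ℕ) {M N : VR R} (b : Fin n → (M ⟶ N)) :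
    (gammaFunctor R s).obj M ⟶ (gammaFunctor R s).obj N :=
  ⟨_, sum_mapsWithFibers_mem_equivariantMaps ν b⟩

theorem val_schurComponent {s n : ℕ} (ν : Fin n → ℕ) {M N : VR R} (b : Fin n → (M ⟶ N)) :
    schurVal s M N (schurComponent (s := s) ν b) =
      ∑ f ∈ mapsWithFibers s ν, PiTensorProduct.map (fun j => VR.lin (b (f j))) := rfl

theorem sum_comp_linearMap {ι M N K : Type*} [AddCommGroup M] [Module R M] [AddCommGroup N]
    [Module R N] [AddCommGroup K] [Module R K] (S : Finset ι) (g : ι → (N →ₗ[R] K))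
    (f : M →ₗ[R] N) : (∑ i ∈ S, g i) ∘ₗ f = ∑ i ∈ S, g i ∘ₗ f :=
  map_sum (LinearMap.lcomp R K f) g S

theorem linearMap_comp_sum {ι M N K : Type*} [AddCommGroup M] [Module R M] [AddCommGroup N]
    [Module R N] [AddCommGroup K] [Module R K] (S : Finset ι) (g : N →ₗ[R] K)
    (f : ι → (M →ₗ[R] N)) : g ∘ₗ (∑ i ∈ S, f i) = ∑ i ∈ S, g ∘ₗ f i :=
  map_sum (LinearMap.llcomp R M N K g) f S

theorem schurComponent_naturality {s n : ℕ} (ν : Fin n → ℕ) {M N M' N' : VR R}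
    (b : Fin n → (M ⟶ N)) (b' : Fin n → (M' ⟶ N')) (f : M ⟶ M') (g : N ⟶ N')
    (h : ∀ i, f ≫ b' i = b i ≫ g) :
    (gammaFunctor R s).map f ≫ schurComponent ν b' =
      schurComponent ν b ≫ (gammaFunctor R s).map g := by
  apply schurVal_injective
  rw [schurVal_comp, schurVal_comp, val_schurComponent, val_schurComponent, schurVal_map,
    schurVal_map,
    sum_comp_linearMap, linearMap_comp_sum]
  refine Finset.sum_congr rfl fun r _ => ?_
  refine (PiTensorProduct.map_comp _ _).symm.trans (Eq.trans ?_ (PiTensorProduct.map_comp _ _))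
  exact congrArg _ (funext fun j => congrArg VR.lin (h (r j)))

section

variable {s n : ℕ} {ν : Fin n → ℕ} {X Y : VR R} {a : Fin n → (X ⟶ Y)} {b : Fin n → (Y ⟶ X)}

theorem map_lin_comp_map_lin (hab : ∀ i j, a i ≫ b j = if i = j then 𝟙 X else 0)
    (r f : Fin s → Fin n) :
    PiTensorProduct.map (fun j => VR.lin (b (f j))) ∘ₗ
      PiTensorProduct.map (fun j => VR.lin (a (r j))) =
        if r = f then LinearMap.id else 0 := by
  rw [← PiTensorProduct.map_comp]
  have h : ∀ j, VR.lin (b (f j)) ∘ₗ VR.lin (a (r j)) = VR.lin (a (r j) ≫ b (f j)) := fun _ => rfl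
  simp only [h, hab]
  split_ifs with hrf
  · subst hrf
    simp only [if_true]
    exact PiTensorProduct.map_id
  · obtain ⟨j, hj⟩ := Function.ne_iff.1 hrf
    refine (PiTensorProduct.mapMultilinear R (fun _ : Fin s => X.obj)
      (fun _ : Fin s => X.obj)).map_coord_zero j ?_
    rw [if_neg hj]
    rfl

theorem mem_filter_piFinset_of_mem_mapsWithFibers (hν : ∀ i, 0 < ν i) {f : Fin s → Fin n}
    (hf : f ∈ mapsWithFibers s ν) :
    f ∈ (Fintype.piFinset fun _ : Fin s => (Finset.univ : Finset (Fin n))).filter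
      fun r => Finset.univ.image r = Finset.univ := by
  simp only [Finset.mem_filter, Fintype.mem_piFinset, Finset.mem_univ, implies_true, true_and]
  exact Finset.image_univ_of_surjective (surjective_of_mem_mapsWithFibers hν hf)

/-- The alternating sum runs over the surjections `Fin s → Fin n`, and the component of multidegree
`ν` over the maps with fibres of cardinalities `ν i`. By biorthogonality only the pairs of equal
maps contribute, each of them the identity. -/
theorem schurAltSum_comp_schurComponent (hν : ∀ i, 0 < ν i)
    (hab : ∀ i j, a i ≫ b j = if i = j then 𝟙 X else 0) :
    schurAltSum s Finset.univ a ≫ schurComponent ν b =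
      ((-1 : ℤ) ^ n * (mapsWithFibers s ν).card) • 𝟙 ((gammaFunctor R s).obj X) := by
  apply schurVal_injective
  rw [schurVal_comp, val_schurAltSum, val_schurComponent, LinearMap.comp_smul,
    sum_comp_linearMap, ← Int.cast_smul_eq_zsmul R,
    map_smul, schurVal_id, Int.cast_mul, mul_smul, Finset.card_univ, Fintype.card_fin,
    Int.cast_pow, Int.cast_neg, Int.cast_one, Int.cast_natCast]
  congr 1
  rw [Nat.cast_smul_eq_nsmul, ← Finset.sum_const]
  refine Finset.sum_congr rfl fun f hf => ?_
  simp only [linearMap_comp_sum, map_lin_comp_map_lin hab]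
  rw [Finset.sum_ite_eq', if_pos (mem_filter_piFinset_of_mem_mapsWithFibers hν hf)]

theorem schurComponent_comp_schurAltSum (hν : ∀ i, 0 < ν i)
    (hab : ∀ i j, a i ≫ b j = if i = j then 𝟙 X else 0) :
    schurComponent ν a ≫ schurAltSum s Finset.univ b =
      ((-1 : ℤ) ^ n * (mapsWithFibers s ν).card) • 𝟙 ((gammaFunctor R s).obj X) := by
  apply schurVal_injective
  rw [schurVal_comp, val_schurAltSum, val_schurComponent, LinearMap.smul_comp,
    linearMap_comp_sum, ← Int.cast_smul_eq_zsmul R,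
    map_smul, schurVal_id, Int.cast_mul, mul_smul, Finset.card_univ, Fintype.card_fin,
    Int.cast_pow, Int.cast_neg, Int.cast_one, Int.cast_natCast]
  congr 1
  rw [Nat.cast_smul_eq_nsmul, ← Finset.sum_const]
  refine Finset.sum_congr rfl fun f hf => ?_
  simp only [sum_comp_linearMap, map_lin_comp_map_lin hab]
  rw [Finset.sum_ite_eq, if_pos (mem_filter_piFinset_of_mem_mapsWithFibers hν hf)]

end

/-- Multiplication by `c` on `V_R` acts by `c ^ s` on a functor of weight `s`. -/
theorem StrictPoly.map_nsmul_id {s : ℕ} (G : StrictPoly.{u, v} R s) (c : ℕ) (X : VR R) :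
    G.underlying.map (c • 𝟙 X) = (c ^ s) • 𝟙 (G.underlying.obj X) := by
  have := G.additive
  have h : (gammaFunctor R s).map (c • 𝟙 X) = (c ^ s) • 𝟙 ((gammaFunctor R s).obj X) := by
    apply schurVal_injective
    rw [← Nat.cast_smul_eq_nsmul R (c ^ s), map_smul]
    have h1 : VR.lin (c • 𝟙 X) = (c : R) • LinearMap.id := by
      rw [Nat.cast_smul_eq_nsmul]
      let φ : (X ⟶ X) →+ (X.obj →ₗ[R] X.obj) :=
        { toFun := VR.lin, map_zero' := rfl, map_add' := fun _ _ => rfl }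
      exact map_nsmul φ c (𝟙 X)
    rw [schurVal_map, schurVal_id, h1]
    refine ((PiTensorProduct.mapMultilinear R (fun _ : Fin s => X.obj)
      (fun _ : Fin s => X.obj)).map_smul_univ (fun _ => (c : R)) fun _ => LinearMap.id).trans ?_
    rw [Finset.prod_const, Finset.card_univ, Fintype.card_fin, PiTensorProduct.mapMultilinear_apply,
      PiTensorProduct.map_id, Nat.cast_pow]
  change G.toFunctor.map ((gammaFunctor R s).map (c • 𝟙 X)) = _
  rw [h, Functor.map_nsmul, G.toFunctor.map_id]
  rfl

/-! ### The self-dual functor `X ↦ R^n ⊗ X` -/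

/-- The free module `R^n`. -/
noncomputable def VR.free (R : Type u) [CommRing R] (n : ℕ) : VR R := VR.of R (Fin n → R)

theorem VR.hom_ext {M N : VR R} {f g : M ⟶ N} (h : ∀ x, VR.lin f x = VR.lin g x) : f = g := by
  apply ObjectProperty.hom_ext; apply ModuleCat.hom_ext; exact LinearMap.ext h

/-- The map `x ↦ e_i ⊗ x` from `X` to `R^n ⊗ X`. -/
noncomputable def VR.coordIncl (R : Type u) [CommRing R] {n : ℕ} (i : Fin n) :
    𝟭 (VR R) ⟶ VR.tensor (VR.free R n) where
  app X := VR.ofHom (N := (VR.tensor (VR.free R n)).obj X)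
    (TensorProduct.mk R (Fin n → R) X.obj (Pi.single i 1))
  naturality _ _ _ := rfl

/-- The map `v ⊗ x ↦ v i • x` from `R^n ⊗ X` to `X`. -/
noncomputable def VR.coordProj (R : Type u) [CommRing R] {n : ℕ} (i : Fin n) :
    VR.tensor (VR.free R n) ⟶ 𝟭 (VR R) where
  app X := VR.ofHom (M := (VR.tensor (VR.free R n)).obj X)
    (TensorProduct.lift ((LinearMap.lsmul R X.obj).comp (LinearMap.proj i)))
  naturality X Y f := by
    apply ObjectProperty.hom_ext; apply ModuleCat.hom_ext
    refine TensorProduct.ext' fun v x => ?_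
    exact ((VR.lin f).map_smul (v i) x).symm

theorem VR.coordIncl_comp_coordProj {n : ℕ} (X : VR R) (i j : Fin n) :
    (VR.coordIncl R i).app X ≫ (VR.coordProj R j).app X = if i = j then 𝟙 X else 0 := by
  have h : ∀ x : X.obj, VR.lin ((VR.coordIncl R i).app X ≫ (VR.coordProj R j).app X) x =
      (Pi.single i (1 : R) : Fin n → R) j • x := fun _ => rfl
  apply VR.hom_ext
  intro x
  rw [h]
  split_ifs with hij
  · subst hij
    rw [Pi.single_eq_same, one_smul]
    rfl
  · rw [Pi.single_eq_of_ne (Ne.symm hij), zero_smul]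
    rfl

theorem VR.sum_coordProj_comp_coordIncl (n : ℕ) (X : VR R) :
    ∑ i : Fin n, (VR.coordProj R i).app X ≫ (VR.coordIncl R i).app X =
      𝟙 ((VR.tensor (VR.free R n)).obj X) := by
  apply ObjectProperty.hom_ext; apply ModuleCat.hom_ext
  refine TensorProduct.ext' fun v x => ?_
  change VR.lin (∑ i : Fin n, (VR.coordProj R i).app X ≫ (VR.coordIncl R i).app X) (v ⊗ₜ[R] x) =
    v ⊗ₜ[R] x
  rw [VR.lin_sum]
  have h : ∀ i, VR.lin ((VR.coordProj R i).app X ≫ (VR.coordIncl R i).app X) (v ⊗ₜ[R] x) =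
    (Pi.single i (v i) : Fin n → R) ⊗ₜ[R] x := by
    intro i
    change (Pi.single i (1 : R) : Fin n → R) ⊗ₜ[R] (v i • x) = _
    rw [← TensorProduct.smul_tmul, ← Pi.single_smul', smul_eq_mul, mul_one]
  refine (LinearMap.sum_apply _ _ _).trans ?_
  rw [Finset.sum_congr rfl fun i _ => h i]
  refine (TensorProduct.sum_tmul _ _ _).symm.trans ?_
  exact congrArg (fun w : Fin n → R => w ⊗ₜ[R] x) (Finset.univ_sum_single fun i => v i)

/-- A functor that is, like `R^n ⊗ -`, a sum of `n` copies of the identity is adjoint to itself. -/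
noncomputable def selfAdjunction {V : Type*} [Category* V] [Preadditive V] (T : V ⥤ V) {n : ℕ}
    (a : Fin n → (𝟭 V ⟶ T)) (b : Fin n → (T ⟶ 𝟭 V))
    (hab : ∀ X i j, (a i).app X ≫ (b j).app X = if i = j then 𝟙 X else 0)
    (hba : ∀ X, ∑ i, (b i).app X ≫ (a i).app X = 𝟙 (T.obj X)) : T ⊣ T :=
  Adjunction.mkOfUnitCounit
    { unit :=
        { app := fun X => ∑ i, (a i).app X ≫ (a i).app (T.obj X)
          naturality := fun X Y f => by
            simp only [Preadditive.comp_sum, Preadditive.sum_comp]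
            refine Finset.sum_congr rfl fun i _ => ?_
            have h1 := (a i).naturality f
            have h2 := (a i).naturality (T.map f)
            dsimp at h1 h2 ⊢
            rw [reassoc_of% h1, h2, Category.assoc] }
      counit :=
        { app := fun X => ∑ i, (b i).app (T.obj X) ≫ (b i).app X
          naturality := fun X Y f => by
            simp only [Preadditive.comp_sum, Preadditive.sum_comp]
            refine Finset.sum_congr rfl fun i _ => ?_
            have h1 := (b i).naturality f
            have h2 := (b i).naturality (T.map f)
            dsimp at h1 h2 ⊢
            rw [reassoc_of% h2, h1, Category.assoc] }
      left_triangle := by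
        ext X
        dsimp
        simp only [Category.id_comp, Preadditive.comp_sum]
        have h : ∀ j, T.map (∑ i, (a i).app X ≫ (a i).app (T.obj X)) ≫
            (b j).app (T.obj (T.obj X)) ≫ (b j).app (T.obj X) = (b j).app X ≫ (a j).app X := by
          intro j
          have h1 := (b j).naturality (∑ i, (a i).app X ≫ (a i).app (T.obj X))
          dsimp at h1
          rw [reassoc_of% h1, Preadditive.sum_comp]
          simp only [Category.assoc, hab]
          simp [comp_ite]
        simp only [h, hba]
      right_triangle := by
        ext X
        dsimp
        simp only [Category.id_comp, Preadditive.sum_comp]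
        have h : ∀ i, ((a i).app (T.obj X) ≫ (a i).app (T.obj (T.obj X))) ≫
            T.map (∑ j, (b j).app (T.obj X) ≫ (b j).app X) = (b i).app X ≫ (a i).app X := by
          intro i
          have h1 := (a i).naturality (∑ j, (b j).app (T.obj X) ≫ (b j).app X)
          dsimp at h1
          rw [Category.assoc, ← h1, Preadditive.sum_comp, Preadditive.comp_sum]
          simp only [Category.assoc, ← Category.assoc ((a i).app _) ((b _).app _), hab]
          simp [ite_comp]
        simp only [h, hba] }

/-! ### Alternating sums as natural transformations -/

theorem map_comp_altSum {ι : Type*} (H : VR R ⥤ ModuleCat.{v} R) {X X' Z Z' : VR R} (T : Finset ι)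
    (f : X ⟶ X') (h : Z ⟶ Z') (g : ι → (X ⟶ Z)) (g' : ι → (X' ⟶ Z'))
    (hg : ∀ i, f ≫ g' i = g i ≫ h) : H.map f ≫ altSum H T g' = altSum H T g ≫ H.map h := by
  simp only [altSum, Preadditive.sum_comp, Preadditive.comp_sum, Preadditive.zsmul_comp,
    Preadditive.comp_zsmul, ← H.map_comp, hg]

variable {n : ℕ} {K : VR R ⥤ VR R}

/-- The transformation `∑_S (-1)^|S| H(∑_{i ∈ S} a i)` from `H` to `K ⋙ H`. -/
noncomputable def altUnit (a : Fin n → (𝟭 (VR R) ⟶ K)) (H : VR R ⥤ ModuleCat.{v} R) :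
    H ⟶ K ⋙ H where
  app X := altSum H Finset.univ fun i => (a i).app X
  naturality _ _ f := map_comp_altSum H _ f (K.map f) _ _ fun i => (a i).naturality f

/-- The transformation `∑_S (-1)^|S| H(∑_{i ∈ S} b i)` from `K ⋙ H` to `H`. -/
noncomputable def altCounit (b : Fin n → (K ⟶ 𝟭 (VR R))) (H : VR R ⥤ ModuleCat.{v} R) :
    K ⋙ H ⟶ H where
  app X := altSum H Finset.univ fun i => (b i).app X
  naturality _ _ f := map_comp_altSum H _ (K.map f) f _ _ fun i => (b i).naturality f

theorem VanishingAltSums.altUnit_eq_zero {H : VR R ⥤ ModuleCat.{v} R} (h : VanishingAltSums H n)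
    (a : Fin n → (𝟭 (VR R) ⟶ K)) : altUnit a H = 0 := by
  ext1; ext1 X
  exact h X (K.obj X) (Finset.univ : Finset (Fin n)) (fun i => (a i).app X) (by simp)

theorem VanishingAltSums.altCounit_eq_zero {H : VR R ⥤ ModuleCat.{v} R} (h : VanishingAltSums H n)
    (b : Fin n → (K ⟶ 𝟭 (VR R))) : altCounit b H = 0 := by
  ext1; ext1 X
  exact h (K.obj X) X (Finset.univ : Finset (Fin n)) (fun i => (b i).app X) (by simp)

theorem VanishingAltSums.of_iso {H H' : VR R ⥤ ModuleCat.{v} R} (e : H ≅ H')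
    (h : VanishingAltSums H' n) : VanishingAltSums H n := by
  intro ι X Z T g hT
  rw [← cancel_mono (e.hom.app Z), altSum_naturality, h X Z T g hT, Limits.comp_zero,
    Limits.zero_comp]

section

variable {s : ℕ} {ν : Fin n → ℕ} {a : Fin n → (𝟭 (VR R) ⟶ K)} {b : Fin n → (K ⟶ 𝟭 (VR R))}

/-- Up to sign, the transformation `altUnit a` of a functor of weight `s` divides the multinomial
coefficient of `ν`: the other factor is the component of multidegree `ν` in the `b i`. -/
theorem StrictPoly.exists_altUnit_comp (G : StrictPoly.{u, v} R s) (hν : ∀ i, 0 < ν i)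
    (hab : ∀ X i j, (a i).app X ≫ (b j).app X = if i = j then 𝟙 X else 0) :
    ∃ β : K ⋙ G.underlying ⟶ G.underlying, altUnit a G.underlying ≫ β =
      ((-1 : ℤ) ^ n * (mapsWithFibers s ν).card) • 𝟙 G.underlying := by
  have := G.additive
  refine ⟨{ app := fun X => G.toFunctor.map (schurComponent ν fun i => (b i).app X)
            naturality := fun X Y f => ?_ }, ?_⟩
  · refine (G.toFunctor.map_comp _ _).symm.trans (Eq.trans ?_ (G.toFunctor.map_comp _ _))
    exact congrArg _ (schurComponent_naturality ν _ _ (K.map f) f fun i => (b i).naturality f)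
  · ext1; ext1 X
    refine (congrArg (· ≫ _) (G.altSum_underlying _ _)).trans ?_
    refine (G.toFunctor.map_comp _ _).symm.trans ?_
    refine (congrArg _ (schurAltSum_comp_schurComponent hν (hab X))).trans ?_
    rw [Functor.map_zsmul]
    exact congrArg _ (G.toFunctor.map_id _)

/-- The dual factorization of a multinomial coefficient, through `altCounit b`. -/
theorem StrictPoly.exists_comp_altCounit (G : StrictPoly.{u, v} R s) (hν : ∀ i, 0 < ν i)
    (hab : ∀ X i j, (a i).app X ≫ (b j).app X = if i = j then 𝟙 X else 0) :
    ∃ α : G.underlying ⟶ K ⋙ G.underlying, α ≫ altCounit b G.underlying =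
      ((-1 : ℤ) ^ n * (mapsWithFibers s ν).card) • 𝟙 G.underlying := by
  have := G.additive
  refine ⟨{ app := fun X => G.toFunctor.map (schurComponent ν fun i => (a i).app X)
            naturality := fun X Y f => ?_ }, ?_⟩
  · refine (G.toFunctor.map_comp _ _).symm.trans (Eq.trans ?_ (G.toFunctor.map_comp _ _))
    exact congrArg _ (schurComponent_naturality ν _ _ f (K.map f) fun i => (a i).naturality f)
  · ext1; ext1 X
    refine (congrArg (_ ≫ ·) (G.altSum_underlying _ _)).trans ?_
    refine (G.toFunctor.map_comp _ _).symm.trans ?_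
    refine (congrArg _ (schurComponent_comp_schurAltSum hν (hab X))).trans ?_
    rw [Functor.map_zsmul]
    exact congrArg _ (G.toFunctor.map_id _)

end

/-- The endomorphism of `H` induced by multiplication by `c` on `V_R`. -/
noncomputable def scalarEnd (c : ℕ) (H : VR R ⥤ ModuleCat.{v} R) : H ⟶ H where
  app X := H.map (c • 𝟙 X)
  naturality X Y f := by
    rw [← H.map_comp, ← H.map_comp, Preadditive.comp_nsmul, Preadditive.nsmul_comp,
      Category.comp_id, Category.id_comp]

theorem scalarEnd_naturality (c : ℕ) {H H' : VR R ⥤ ModuleCat.{v} R} (φ : H ⟶ H') :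
    φ ≫ scalarEnd c H' = scalarEnd c H ≫ φ := by
  ext1; ext1 X
  exact (φ.naturality _).symm

theorem StrictPoly.scalarEnd_eq {t : ℕ} (G : StrictPoly.{u, v} R t)
    {H : VR R ⥤ ModuleCat.{v} R} (e : H ≅ G.underlying) (c : ℕ) :
    scalarEnd c H = ((c ^ t : ℕ) : ℤ) • 𝟙 H := by
  have h : scalarEnd c G.underlying = (c ^ t) • 𝟙 G.underlying := by
    ext1; ext1 X
    exact G.map_nsmul_id c X
  rw [← cancel_mono e.hom, ← scalarEnd_naturality, h, natCast_zsmul, Preadditive.nsmul_comp,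
    Preadditive.comp_nsmul, Category.comp_id, Category.id_comp]

/-! ### Precomposition on a full abelian subcategory -/

section FullSubcategory

/-- An additive category carries only one preadditive structure, so the inclusion of a full
subcategory is additive for whatever preadditive structure that subcategory comes with. -/
theorem additive_ι {D : Type*} [Category* D] [Preadditive D] (P : ObjectProperty D)
    [A : Abelian P.FullSubcategory] :
    @Functor.Additive _ _ _ _ A.toPreadditive _ P.ι := by
  let z := @Preadditive.preadditiveHasZeroMorphisms _ _ A.toPreadditive
  have hb : @Limits.HasBinaryBiproducts P.FullSubcategory _ z := Abelian.hasBinaryBiproducts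
  have h : A.toPreadditive = Preadditive.fullSubcategory P :=
    (@subsingleton_preadditive_of_hasBinaryBiproducts _ _ z hb).elim _ _
  rw [h]
  exact { map_add := rfl }

theorem eq_zsmul_id_of_hom_eq {D : Type*} [Category* D] [Preadditive D] {P : ObjectProperty D}
    [A : Abelian P.FullSubcategory] {X : P.FullSubcategory} (f : X ⟶ X) (m : ℤ)
    (hf : f.hom = m • 𝟙 X.obj) : f = letI := A.toPreadditive; m • 𝟙 X := by
  let := A.toPreadditive
  have := additive_ι P
  apply P.ι.map_injective
  rw [Functor.map_zsmul, P.ι.map_id]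
  exact hf

theorem eq_zero_of_map_eq_zero {C D : Type*} [Category* C] [Category* D] [Preadditive C]
    [Preadditive D] (ι : C ⥤ D) [ι.Additive] [ι.Faithful] {X Y : C} (f : X ⟶ Y)
    (hf : ι.map f = 0) : f = 0 :=
  ι.map_injective (hf.trans (ι.map_zero X Y).symm)

theorem eq_zero_of_hom_eq_zero {D : Type*} [Category* D] [Preadditive D] {P : ObjectProperty D}
    [A : Abelian P.FullSubcategory] {X Y : P.FullSubcategory} (f : X ⟶ Y) (hf : f.hom = 0) :
    f = letI := @Preadditive.preadditiveHasZeroMorphisms _ _ A.toPreadditive; 0 :=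
  @eq_zero_of_map_eq_zero _ _ _ _ A.toPreadditive _ P.ι (additive_ι P) _ X Y f hf

theorem nsmul_eq_zero_of_neg_one_pow_mul_zsmul {A : Type*} [AddCommGroup A] {n N : ℕ} {x : A}
    (h : ((-1 : ℤ) ^ n * N) • x = 0) : N • x = 0 := by
  rw [mul_smul, natCast_zsmul] at h
  rcases neg_one_pow_eq_or ℤ n with h1 | h1
  · rwa [h1, one_smul] at h
  · rwa [h1, neg_one_smul, neg_eq_zero] at h

variable (P : ObjectProperty (VR R ⥤ ModuleCat.{u} R))

section

variable {P}
variable (hlower : ∀ (M : VR R) (H : VR R ⥤ ModuleCat.{u} R), P H → P (VR.tensor M ⋙ H)) (n)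

/-- The functor `H ↦ H(R^n ⊗ -)` on the subcategory. -/
noncomputable def precompFree : P.FullSubcategory ⥤ P.FullSubcategory :=
  P.lift (P.ι ⋙ (Functor.whiskeringLeft _ _ _).obj (VR.tensor (VR.free R n)))
    fun H => hlower _ _ H.property

/-- Since `R^n` is its own dual, `H ↦ H(R^n ⊗ -)` is its own left and right adjoint. -/
noncomputable def precompFreeAdjunction : precompFree n hlower ⊣ precompFree n hlower :=
  ((selfAdjunction (VR.tensor (VR.free R n)) (fun i => VR.coordIncl R i)
    (fun i => VR.coordProj R i) VR.coordIncl_comp_coordProj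
    (VR.sum_coordProj_comp_coordIncl n)).whiskerLeft (ModuleCat.{u} R)).restrictFullyFaithful
      P.fullyFaithfulι P.fullyFaithfulι (Iso.refl _) (Iso.refl _)

/-- The transformations `altUnit` for the coordinate inclusions, on the subcategory. -/
noncomputable def precompFreeUnit : 𝟭 P.FullSubcategory ⟶ precompFree n hlower where
  app H := ObjectProperty.homMk (altUnit (fun i => VR.coordIncl R i) H.obj)
  naturality H H' φ := by
    apply ObjectProperty.hom_ext
    ext1; ext1 X
    exact (altSum_naturality φ.hom _ _).symm

/-- The transformations `altCounit` for the coordinate projections, on the subcategory. -/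
noncomputable def precompFreeCounit : precompFree n hlower ⟶ 𝟭 P.FullSubcategory where
  app H := ObjectProperty.homMk (altCounit (fun i => VR.coordProj R i) H.obj)
  naturality H H' φ := by
    apply ObjectProperty.hom_ext
    ext1; ext1 X
    exact (altSum_naturality φ.hom _ _).symm

end

variable [A : Abelian P.FullSubcategory]
variable (hlower : ∀ (M : VR R) (H : VR R ⥤ ModuleCat.{u} R), P H → P (VR.tensor M ⋙ H)) (n)

instance preservesFiniteLimits_precompFree : Limits.PreservesFiniteLimits (precompFree n hlower) :=
  have := (precompFreeAdjunction n hlower).rightAdjoint_preservesLimits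
  inferInstance

instance preservesFiniteColimits_precompFree :
    Limits.PreservesFiniteColimits (precompFree n hlower) :=
  have := (precompFreeAdjunction n hlower).leftAdjoint_preservesColimits
  inferInstance

theorem additive_precompFree :
    @Functor.Additive _ _ _ _ A.toPreadditive A.toPreadditive (precompFree n hlower) :=
  letI := A.toPreadditive
  Functor.additive_of_preserves_binary_products _

variable [EnoughInjectives P.FullSubcategory] [HasExt.{w} P.FullSubcategory]
variable {P} {n}

/-- If `F` has vanishing differences of order `n` and `G` has weight `s`, then the multinomial
coefficients of the compositions of `s` into `n` positive parts kill `Ext(F, G)`. -/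
theorem card_nsmul_ext_eq_zero_of_left
    (hlower : ∀ (M : VR R) (H : VR R ⥤ ModuleCat.{u} R), P H → P (VR.tensor M ⋙ H))
    {F : VR R ⥤ ModuleCat.{u} R} (hF : P F) (hFn : VanishingAltSums F n)
    {s : ℕ} (G : StrictPoly.{u, u} R s) (hG : P G.underlying)
    {ν : Fin n → ℕ} (hν : ∀ i, 0 < ν i) {i : ℕ}
    (x : Abelian.Ext (C := P.FullSubcategory) ⟨F, hF⟩ ⟨G.underlying, hG⟩ i) :
    (mapsWithFibers s ν).card • x = 0 := by
  have := additive_precompFree n P hlower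
  obtain ⟨β, hβ⟩ := G.exists_altUnit_comp (a := fun i => VR.coordIncl R i)
    (b := fun i => VR.coordProj R i) hν VR.coordIncl_comp_coordProj
  have h := zsmul_ext_eq_zero_of_unit (precompFreeUnit n hlower)
    (X := ⟨F, hF⟩) (Y := ⟨G.underlying, hG⟩) (eq_zero_of_hom_eq_zero _ (hFn.altUnit_eq_zero _))
    (ObjectProperty.homMk β) (eq_zsmul_id_of_hom_eq (X := ⟨G.underlying, hG⟩) _ _ hβ) x
  exact nsmul_eq_zero_of_neg_one_pow_mul_zsmul h

/-- If `F` has weight `t` and `G` has vanishing differences of order `n`, then the multinomial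
coefficients of the compositions of `t` into `n` positive parts kill `Ext(F, G)`. -/
theorem card_nsmul_ext_eq_zero_of_right
    (hlower : ∀ (M : VR R) (H : VR R ⥤ ModuleCat.{u} R), P H → P (VR.tensor M ⋙ H))
    {F : VR R ⥤ ModuleCat.{u} R} (hF : P F) {t : ℕ} (F' : StrictPoly.{u, u} R t)
    (e : F ≅ F'.underlying) {G : VR R ⥤ ModuleCat.{u} R} (hG : P G) (hGn : VanishingAltSums G n)
    {ν : Fin n → ℕ} (hν : ∀ i, 0 < ν i) {i : ℕ}
    (x : Abelian.Ext (C := P.FullSubcategory) ⟨F, hF⟩ ⟨G, hG⟩ i) :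
    (mapsWithFibers t ν).card • x = 0 := by
  have := additive_precompFree n P hlower
  obtain ⟨α, hα⟩ := F'.exists_comp_altCounit (a := fun i => VR.coordIncl R i)
    (b := fun i => VR.coordProj R i) hν VR.coordIncl_comp_coordProj
  let T := VR.tensor (VR.free R n)
  have hα' : (e.hom ≫ α ≫ Functor.whiskerLeft T e.inv) ≫
      altCounit (fun i => VR.coordProj R i) F =
        ((-1 : ℤ) ^ n * (mapsWithFibers t ν).card) • 𝟙 F := by
    have h1 : Functor.whiskerLeft T e.inv ≫ altCounit (fun i => VR.coordProj R i) F =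
        altCounit (fun i => VR.coordProj R i) F'.underlying ≫ e.inv := by
      ext1; ext1 X
      exact (altSum_naturality e.inv _ _).symm
    rw [Category.assoc, Category.assoc, h1, reassoc_of% hα, Preadditive.zsmul_comp,
      Preadditive.comp_zsmul, Category.id_comp, e.hom_inv_id]
  have h := zsmul_ext_eq_zero_of_counit (precompFreeCounit n hlower)
    (X := ⟨F, hF⟩) (Y := ⟨G, hG⟩) (eq_zero_of_hom_eq_zero _ (hGn.altCounit_eq_zero _))
    (ObjectProperty.homMk (e.hom ≫ α ≫ Functor.whiskerLeft T e.inv))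
    (eq_zsmul_id_of_hom_eq (X := ⟨F, hF⟩) _ _ hα') x
  exact nsmul_eq_zero_of_neg_one_pow_mul_zsmul h

/-- The two actions of an integer `c` on `Ext(F, G)` through `F` and through `G` agree. -/
theorem pow_nsmul_ext_eq {F : VR R ⥤ ModuleCat.{u} R} (hF : P F) {t : ℕ}
    (F' : StrictPoly.{u, u} R t) (e : F ≅ F'.underlying) {s : ℕ} (G : StrictPoly.{u, u} R s)
    (hG : P G.underlying) (c : ℕ) {i : ℕ}
    (x : Abelian.Ext (C := P.FullSubcategory) ⟨F, hF⟩ ⟨G.underlying, hG⟩ i) :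
    c ^ s • x = c ^ t • x := by
  let τ : 𝟭 P.FullSubcategory ⟶ 𝟭 P.FullSubcategory :=
    { app := fun H => ObjectProperty.homMk (scalarEnd c H.obj)
      naturality := fun H H' φ => by
        apply ObjectProperty.hom_ext
        exact scalarEnd_naturality c φ.hom }
  have h := zsmul_ext_eq_zsmul τ
    (eq_zsmul_id_of_hom_eq (X := ⟨F, hF⟩) _ _ (F'.scalarEnd_eq e c))
    (eq_zsmul_id_of_hom_eq (X := ⟨G.underlying, hG⟩) _ _ (G.scalarEnd_eq (Iso.refl _) c)) x
  simpa only [natCast_zsmul] using h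

end FullSubcategory

/-! ### Arithmetic of the action on a torsion class -/

theorem pow_smul_eq_zero_of_coprime {A : Type*} [AddCommGroup A] {p r c k : ℕ} {x : A}
    (hc : p.Coprime c) (h : (p ^ r * c) • x = 0) (hk : p ^ k • x = 0) : p ^ r • x = 0 := by
  rw [← addOrderOf_dvd_iff_nsmul_eq_zero] at h hk ⊢
  exact (((hc.pow_left k).coprime_dvd_left hk)).dvd_of_dvd_mul_right h

/-- If all integers act on an element of order `p` through their `s`-th and through their `t`-th
powers, then `s ≡ t` modulo `p - 1`, since there is a primitive root modulo `p`. -/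
theorem modEq_of_pow_nsmul_eq {A : Type*} [AddCommGroup A] {p s t : ℕ} (hp : p.Prime) {x : A}
    (hx : x ≠ 0) (hpx : p • x = 0) (h : ∀ c : ℕ, c ^ s • x = c ^ t • x) : s ≡ t [MOD p - 1] := by
  have := Fact.mk hp
  obtain ⟨g, hg⟩ := IsCyclic.exists_generator (α := (ZMod p)ˣ)
  have hord : orderOf g = p - 1 := by
    rw [orderOf_eq_card_of_forall_mem_zpowers hg, Nat.card_eq_fintype_card, ZMod.card_units]
  have hxp : addOrderOf x = p := addOrderOf_eq_prime hpx hx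
  have h1 := h (g : ZMod p).val
  rw [nsmul_eq_nsmul_iff_modEq, hxp, ← ZMod.natCast_eq_natCast_iff] at h1
  rw [← hord, ← pow_eq_pow_iff_modEq]
  ext
  simpa using h1

theorem eq_zero_of_prime_pow_smul {A : Type*} [AddCommGroup A] {p : ℕ}
    (h : ∀ x : A, p • x = 0 → x = 0) (k : ℕ) (x : A) (hx : p ^ k • x = 0) : x = 0 := by
  induction k generalizing x with
  | zero => simpa using hx
  | succ k ih => exact h x (ih _ (by rwa [pow_succ, mul_smul] at hx))

/-- If `s ≡ t` modulo `p - 1`, then `min s t` lies in both intervals as soon as neither digit sum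
exceeds the other number. -/
theorem interval_inter_nonempty {p s t : ℕ} (hst : s ≡ t [MOD p - 1])
    (h1 : digitSum p s ≤ t) (h2 : digitSum p t ≤ s) : (interval p t ∩ interval p s).Nonempty := by
  have hs : digitSum p s ≤ s := Nat.digit_sum_le p s
  have ht : digitSum p t ≤ t := Nat.digit_sum_le p t
  refine ⟨min s t, ⟨?_, le_min h2 ht, min_le_right _ _⟩, ?_, le_min hs h1, min_le_left _ _⟩
  · rcases min_choice s t with h | h <;> rw [h]
    exact hst
  · rcases min_choice s t with h | h <;> rw [h]
    exact hst.symm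

end PolyFun

theorem mainTheorem6 {R : Type u} [CommRing R]
    -- a full abelian subcategory of the category of all functors from `V_R` to `R`-modules
    (P : ObjectProperty (PolyFun.VR R ⥤ ModuleCat.{u} R))
    [Abelian P.FullSubcategory] [EnoughProjectives P.FullSubcategory]
    [EnoughInjectives P.FullSubcategory] [HasExt.{w} P.FullSubcategory]
    -- stable under `F ↦ F_M = F(M ⊗ -)` and `F ↦ F^M = F(Hom(M, -))`
    (hlower : ∀ (M : PolyFun.VR R) (H : PolyFun.VR R ⥤ ModuleCat.{u} R),
      P H → P (PolyFun.VR.tensor M ⋙ H))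
    (hupper : ∀ (M : PolyFun.VR R) (H : PolyFun.VR R ⥤ ModuleCat.{u} R),
      P H → P (PolyFun.VR.homFrom M ⋙ H))
    (F : PolyFun.VR R ⥤ ModuleCat.{u} R) (hF : P F)
    (d : WithBot ℕ) (hd : PolyFun.HasDegree F d)
    (s : ℕ) (hs : 0 < s) (G : PolyFun.StrictPoly.{u, u} R s) (hG : P G.underlying)
    (hds : d < (s : WithBot ℕ)) (i : ℕ) :
    (∀ x : Abelian.Ext (C := P.FullSubcategory) ⟨F, hF⟩ ⟨G.underlying, hG⟩ i,
      ∃ n : ℕ, 0 < n ∧ n • x = 0) ∧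
    (∀ p : ℕ, p.Prime →
      ∀ x : Abelian.Ext (C := P.FullSubcategory) ⟨F, hF⟩ ⟨G.underlying, hG⟩ i,
        (∃ k : ℕ, p ^ k • x = 0) → p ^ PolyFun.torsionExponent p s d • x = 0) ∧
    (∀ (t : ℕ) (F' : PolyFun.StrictPoly.{u, u} R t), Nonempty (F ≅ F'.underlying) →
      ∀ p : ℕ, p.Prime → PolyFun.interval p t ∩ PolyFun.interval p s = ∅ →
        ∀ x : Abelian.Ext (C := P.FullSubcategory) ⟨F, hF⟩ ⟨G.underlying, hG⟩ i,
          (∃ k : ℕ, p ^ k • x = 0) → x = 0) := by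
  -- a multinomial coefficient whose `p`-adic valuation is the required exponent kills `Ext(F, G)`
  have key : ∀ p : ℕ, p.Prime → ∃ c : ℕ, p.Coprime c ∧
      ∀ x : Abelian.Ext (C := P.FullSubcategory) ⟨F, hF⟩ ⟨G.underlying, hG⟩ i,
        (p ^ PolyFun.torsionExponent p s d * c) • x = 0 := by
    intro p hp
    obtain ⟨h1, h2⟩ := PolyFun.torsionExponent_bounds hp d hds
    obtain ⟨n, hn⟩ : ∃ n, PolyFun.digitSum p s + (p - 1) * PolyFun.torsionExponent p s d = n + 1 :=
      Nat.exists_eq_add_one_of_ne_zero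
        (Nat.add_pos_left (PolyFun.digitSum_pos hs) _).ne'
    obtain ⟨ν, hν, c, hc, hpc⟩ :=
      PolyFun.exists_padicValNat_card_mapsWithFibers hp s _ (n + 1) hn.symm (hn ▸ h2)
    refine ⟨c, hpc, fun x => ?_⟩
    rw [← hc]
    exact PolyFun.card_nsmul_ext_eq_zero_of_left hlower hF
      (hd.degreeLE (hn ▸ h1)).vanishingAltSums G hG hν x
  refine ⟨fun x => ?_, fun p hp x ⟨k, hk⟩ => ?_, fun t F' ⟨e⟩ p hp hint x ⟨k, hk⟩ => ?_⟩
  · obtain ⟨c, hc, h⟩ := key 2 Nat.prime_two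
    refine ⟨_, Nat.mul_pos (Nat.pow_pos two_pos) (Nat.pos_of_ne_zero ?_), h x⟩
    rintro rfl
    norm_num at hc
  · obtain ⟨c, hc, h⟩ := key p hp
    exact PolyFun.pow_smul_eq_zero_of_coprime hc (h x) hk
  -- a nonzero class killed by `p` would put `min s t` into both intervals
  · refine PolyFun.eq_zero_of_prime_pow_smul (fun x hpx => ?_) k x hk
    have hpx' : p ^ 1 • x = 0 := by rwa [pow_one]
    by_contra hx
    refine Set.not_nonempty_iff_eq_empty.2 hint (PolyFun.interval_inter_nonempty
      (PolyFun.modEq_of_pow_nsmul_eq hp hx hpx fun c =>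
        PolyFun.pow_nsmul_ext_eq hF F' e G hG c x) ?_ ?_)
    · by_contra! hlt
      obtain ⟨ν, hν, c, hc, hpc⟩ := PolyFun.exists_padicValNat_card_mapsWithFibers hp s 0
        (PolyFun.digitSum p s) (by simp) (Nat.digit_sum_le p s)
      have h := PolyFun.card_nsmul_ext_eq_zero_of_left hlower hF
        ((F'.vanishingAltSums hlt).of_iso e) G hG hν x
      rw [hc] at h
      exact hx (by simpa using PolyFun.pow_smul_eq_zero_of_coprime hpc h hpx')
    · by_contra! hlt
      obtain ⟨ν, hν, c, hc, hpc⟩ := PolyFun.exists_padicValNat_card_mapsWithFibers hp t 0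
        (PolyFun.digitSum p t) (by simp) (Nat.digit_sum_le p t)
      have h := PolyFun.card_nsmul_ext_eq_zero_of_right hlower hF F' e hG
        (G.vanishingAltSums hlt) hν x
      rw [hc] at h
      exact hx (by simpa using PolyFun.pow_smul_eq_zero_of_coprime hpc h hpx')
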